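/- \textbf{Conventions.} C$^*$-algebras and Hilbert spaces are separable. A \emph{spectral triple} $(\mathcal A,H,D)$ on a C$^*$-algebra $A$ consists of a faithful (possibly degenerate) $^*$-representation $\pi:A\to B(H)$, a dense $^*$-subalgebra $\mathcal A\subseteq A$ and a densely defined self-adjoint operator $D$ on $H$ such that, for $a\in\mathcal A$, $\pi(a)\,\mathrm{dom}(D)\subseteq\mathrm{dom}(D)$ and $[D,\pi(a)]$ extends to a bounded operator, and such that $\pi(a)(I+D^2)^{-1}$ is compact for all $a\in A$. Its spectral dimension is $s_0=\inf\{p\in(0,\infty): (I+D^2)^{-p/2}\text{ lies in the Dixmier class}\}\in[0,\infty]$, where $T$ lies in the Dixmier class if the sum of its $N$ largest singular values is $O(\log N)$. If $A$ is unital, put $L_D(a)=\|[D,\pi(a)]\|$ for $a\in\mathcal A$. The triple satisfies \emph{Rieffel's metric condition} if $L_D(1)=0$ when $1\in\mathcal A$, $L_D(a)=0$ with $a\in\mathcal A$ implies $a\in\mathbb C1$, the state space $S(A)$ has finite diameter for $d(\omega_1,\omega_2)=\sup\{|\omega_1(a)-\omega_2(a)|:a\in\mathcal A,\ L_D(a)\le1\}$,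 and $\{a\in\mathcal A:\|a\|\le1,\ L_D(a)\le1\}$ is totally bounded in norm. \textbf{Setting.} Let $A$ be a unital C$^*$-algebra with a spectral triple $(\mathcal A,H_A,D_A)$ whose representation $\pi_A$ is unital. Let $P\in B(H_A)$ be an orthogonal projection of infinite rank with $[P,\pi_A(a)]$ compact for all $a\in A$ and $P\pi_A(A)P\cap\mathcal K(PH_A)=\{0\}$. Let $0\to\mathcal K(PH_A)\to E\xrightarrow{\sigma}A\to0$ be a unital extension, and let $\pi:E\to B(H_A)$ be a faithful representation that maps $E$ onto $P\pi_A(A)P+\mathcal K(PH_A)$ and under which $\sigma(P\pi_A(a)P+k)=a$ for $a\in A$, $k\in\mathcal K(PH_A)$; so $\ker\sigma=\pi^{-1}(\mathcal K(PH_A))$. Let $\mathcal C(H_A)$ be the set of compact operators $y$ with $y\,\mathrm{dom}(D_A)\subseteq\mathrm{dom}(D_A)$ such that $yD_A$ and $D_Ay$, defined on $\mathrm{dom}(D_A)$, extend to bounded operators, and let $\mathcal C(PH_A)=\{y\in\mathcal C(H_A):PyP=y\}$. Suppose that $P\,\mathrm{dom}(D_A)\subseteq\mathrm{dom}(D_A)$,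 that $PD_A=D_AP$ on $\mathrm{dom}(D_A)$, and that $[P,\pi_A(a)]\in\mathcal C(H_A)$ for all $a\in\mathcal A$. Put $D_A^p=PD_A$, $D_A^q=(1-P)D_A$ and $\pi_\sigma=\pi_A\circ\sigma$, and let $\mathcal E$ be the $^*$-subalgebra of $E$ generated by $\pi^{-1}(\mathcal C(PH_A))$ and $\pi^{-1}(P\pi_A(\mathcal A)P)$. Let $s\in\{1,-1\}$. \textbf{Proposition (Extensions by compacts).} On $H=H_A\otimes\mathbb C^6$ let $\Pi=\pi_\sigma\oplus\pi_\sigma\oplus\pi\oplus\pi_\sigma\oplus\pi\oplus\pi_\sigma$ and, with domain $\mathrm{dom}(D_A)\otimes\mathbb C^6$, $$D=\begin{bmatrix}D_A&0&0&0&0&0\\0&-D_A&0&0&0&0\\0&0&0&0&D_A^q&D_A^p\\0&0&0&0&D_A^p&s\,D_A^q\\0&0&D_A^q&D_A^p&0&0\\0&0&D_A^p&s\,D_A^q&0&0\end{bmatrix}.$$ Then: \begin{enumerate} \item $(\mathcal E,H,D)$, represented via $\Pi$, is a spectral triple on $E$. \item Its spectral dimension equals that of $(\mathcal A,H_A,D_A)$.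 \item If $D_A^p$ is invertible as an operator on $PH_A$ (equivalently, since it has compact resolvent, $\ker(D_A)\cap PH_A=\{0\}$) and $(\mathcal A,H_A,D_A)$ satisfies Rieffel's metric condition, then so does $(\mathcal E,H,D)$. \end{enumerate} -/

import Mathlib

open scoped ENNReal ComplexOrder

noncomputable section

namespace ToeplitzExt

/-! ## Unbounded operators, commutators and spectral triples -/

section Operators

variable {H : Type*} [NormedAddCommGroup H] [InnerProductSpace ℂ H] [CompleteSpace H]

/-- `x` maps `dom D` into `dom D`, and the commutator `[D, x] = D x - x D`, defined on `dom D`,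
is the restriction to `dom D` of the bounded operator `T`. -/
def HasCommutator (D : H →ₗ.[ℂ] H) (x T : H →L[ℂ] H) : Prop :=
  ∀ ξ : D.domain, ∃ h : x ξ ∈ D.domain, D ⟨x ξ, h⟩ - x (D ξ) = T ξ

/-- The norm `‖[D, x]‖ ∈ [0, ∞]` of the bounded extension of the commutator (which is unique, as
`D` is densely defined), with value `∞` if there is no such extension. -/
def commNorm (D : H →ₗ.[ℂ] H) (x : H →L[ℂ] H) : ℝ≥0∞ :=
  ⨅ (T : H →L[ℂ] H) (_ : HasCommutator D x T), ‖T‖ₑ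

/-- `R = (I + D²)⁻¹`: the bounded operator `R` takes values in `dom D²` and is a two-sided inverse
of `I + D² : dom D² → H`. -/
structure IsInvOneAddSq (D : H →ₗ.[ℂ] H) (R : H →L[ℂ] H) : Prop where
  right_inv : ∀ ξ : H, ∃ (h : R ξ ∈ D.domain) (h' : D ⟨R ξ, h⟩ ∈ D.domain),
    R ξ + D ⟨D ⟨R ξ, h⟩, h'⟩ = ξ
  left_inv : ∀ (ξ : D.domain) (h : D ξ ∈ D.domain), R ((ξ : H) + D ⟨D ξ, h⟩) = ξ

/-- A spectral triple `(𝒜, H, D)` on the C⋆-algebra `A`, represented via `π`. Neither the algebra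
nor the representation has to be unital. -/
structure IsSpectralTriple {A : Type*} [NonUnitalCStarAlgebra A]
    (𝒜 : NonUnitalStarSubalgebra ℂ A) (π : A →⋆ₙₐ[ℂ] (H →L[ℂ] H)) (D : H →ₗ.[ℂ] H) : Prop where
  faithful : Function.Injective π
  dense : Dense (𝒜 : Set A)
  dense_domain : Dense (D.domain : Set H)
  selfAdjoint : IsSelfAdjoint D
  bounded_commutator : ∀ a ∈ 𝒜, ∃ T : H →L[ℂ] H, HasCommutator D (π a) T
  compact_resolvent : ∃ R : H →L[ℂ] H, IsInvOneAddSq D R ∧ ∀ a : A, IsCompactOperator (π a * R)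

/-! ## Spectral dimension -/

/-- The `n`-th singular value of a bounded operator, as its distance to the operators of rank at
most `n`. -/
def singularValue (T : H →L[ℂ] H) (n : ℕ) : ℝ :=
  sInf {r : ℝ | ∃ F : H →L[ℂ] H, LinearMap.rank (F : H →ₗ[ℂ] H) ≤ (n : Cardinal) ∧ r = ‖T - F‖}

/-- The Dixmier class: the sum of the first `N` singular values is `O(log N)`. (Such an operator is
automatically compact.) -/
def InDixmierClass (T : H →L[ℂ] H) : Prop :=
  ∃ C : ℝ, ∀ N : ℕ, ∑ n ∈ Finset.range N, singularValue T n ≤ C * Real.log (1 + N)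

/-- `p`-summability: `(I + D²)^(-p/2)` is in the Dixmier class. The power is formed with the
continuous functional calculus of the positive operator `(I + D²)⁻¹`. -/
def IsSummable (D : H →ₗ.[ℂ] H) (p : ℝ) : Prop :=
  ∃ R : H →L[ℂ] H, IsInvOneAddSq D R ∧ InDixmierClass (cfc (fun t : ℝ => t ^ (p / 2)) R)

/-- The spectral dimension `s₀(D) = inf {p ∈ (0, ∞) : D is p-summable}`; it is `∞` if `D` is not
`p`-summable for any `p`. -/
def spectralDim (D : H →ₗ.[ℂ] H) : ℝ≥0∞ :=
  ⨅ (p : ℝ) (_ : 0 < p) (_ : IsSummable D p), ENNReal.ofReal p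

/-! ## Rieffel's metric condition -/

/-- States of a unital C⋆-algebra. -/
structure IsState {A : Type*} [CStarAlgebra A] (ω : A →L[ℂ] ℂ) : Prop where
  nonneg : ∀ a : A, 0 ≤ ω (star a * a)
  map_one : ω 1 = 1

/-- The extended distance `sup {|ω₁(a) - ω₂(a)| : a ∈ 𝒜, ‖[D, π(a)]‖ ≤ 1}`. -/
def stateDist {A : Type*} [CStarAlgebra A] (𝒜 : NonUnitalStarSubalgebra ℂ A)
    (π : A →⋆ₙₐ[ℂ] (H →L[ℂ] H)) (D : H →ₗ.[ℂ] H) (ω₁ ω₂ : A →L[ℂ] ℂ) : ℝ≥0∞ :=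
  ⨆ (a : A) (_ : a ∈ 𝒜) (_ : commNorm D (π a) ≤ 1), ‖ω₁ a - ω₂ a‖ₑ

/-- Rieffel's metric condition for the seminorm `L(a) = ‖[D, π(a)]‖` on the dense subalgebra `𝒜` of
the unital C⋆-algebra `A`: `L` vanishes at the unit (if it lies in `𝒜`), its kernel consists of
scalar multiples of the unit, the induced metric on the state space has finite diameter, and the
part of the unit ball where `L ≤ 1` is totally bounded in norm. -/
structure RieffelMetricCondition {A : Type*} [CStarAlgebra A] (𝒜 : NonUnitalStarSubalgebra ℂ A)
    (π : A →⋆ₙₐ[ℂ] (H →L[ℂ] H)) (D : H →ₗ.[ℂ] H) : Prop where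
  map_one : (1 : A) ∈ 𝒜 → commNorm D (π 1) = 0
  nondegenerate : ∀ a ∈ 𝒜, commNorm D (π a) = 0 → ∃ c : ℂ, a = algebraMap ℂ A c
  finite_diam : ∃ r : ℝ, ∀ ω₁ ω₂ : A →L[ℂ] ℂ, IsState ω₁ → IsState ω₂ →
    stateDist 𝒜 π D ω₁ ω₂ ≤ ENNReal.ofReal r
  totallyBounded : TotallyBounded {a : A | a ∈ 𝒜 ∧ commNorm D (π a) ≤ 1 ∧ ‖a‖ ≤ 1}

/-! ## Toeplitz type extensions by compacts -/

/-- `k ∈ 𝒦(P H)`: compact operators on `P H`, regarded as operators on `H` that vanish on the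
orthogonal complement of `P H`. -/
def IsCompactOn (P k : H →L[ℂ] H) : Prop :=
  IsCompactOperator k ∧ P * k * P = k

/-- The unital extension `0 → 𝒦(P H) → E → A → 0` with quotient map `σ`, where `π` is an
isomorphism of `E` with the algebra `P A P + 𝒦(P H)` of operators on `H`, `P` is an infinite
dimensional projection which commutes with `A` modulo the compacts, and the subspaces `P A P` and
`𝒦(P H)` have trivial intersection. Here `A` acts on `H` through the unital representation `πA`. -/
structure IsToeplitzExtension {A E : Type*} [CStarAlgebra A] [CStarAlgebra E]
    (πA : A →⋆ₐ[ℂ] (H →L[ℂ] H)) (P : H →L[ℂ] H)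
    (σ : E →⋆ₐ[ℂ] A) (π : E →⋆ₙₐ[ℂ] (H →L[ℂ] H)) : Prop where
  projection : IsStarProjection P
  infinite : ¬ FiniteDimensional ℂ (LinearMap.range (P : H →ₗ[ℂ] H))
  compact_commutator : ∀ a : A, IsCompactOperator (P * πA a - πA a * P)
  disjoint : ∀ a : A, IsCompactOperator (P * πA a * P) → P * πA a * P = 0
  injective : Function.Injective π
  surjective : Function.Surjective σ
  compacts_le_range : ∀ k : H →L[ℂ] H, IsCompactOn P k → ∃ e : E, π e = k
  exact : ∀ e : E, σ e = 0 ↔ IsCompactOn P (π e)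
  decomposition : ∀ e : E, ∃ k : H →L[ℂ] H, IsCompactOn P k ∧ π e = P * πA (σ e) * P + k

/-- The `D`-differentiable compacts `𝒞(H)`: compact operators `y` that leave `dom D` invariant, with
`y D` and `D y`, defined on `dom D`, extending to bounded operators on `H`. -/
structure IsDiffCompact (D : H →ₗ.[ℂ] H) (y : H →L[ℂ] H) : Prop where
  compact : IsCompactOperator y
  map_domain : ∀ ξ ∈ D.domain, y ξ ∈ D.domain
  bounded_right : ∃ S : H →L[ℂ] H, ∀ ξ : D.domain, y (D ξ) = S ξ
  bounded_left : ∃ T : H →L[ℂ] H, ∀ ξ : D.domain, D ⟨y ξ, map_domain ξ ξ.2⟩ = T ξ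

/-- The smoothness part of "the quadruple `(𝒜, H, D, P)` is of Toeplitz type": `P` commutes with `D`
and `[P, a]` is a `D`-differentiable compact operator for all `a ∈ 𝒜`. -/
structure IsToeplitzQuadruple {A : Type*} [CStarAlgebra A] (𝒜 : NonUnitalStarSubalgebra ℂ A)
    (πA : A →⋆ₐ[ℂ] (H →L[ℂ] H)) (D : H →ₗ.[ℂ] H) (P : H →L[ℂ] H) : Prop where
  commute : HasCommutator D P 0
  regular : ∀ a ∈ 𝒜, IsDiffCompact D (P * πA a - πA a * P)

/-- The compression of `D` to `P H` is invertible: as `D` has compact resolvent, this means that its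
kernel is trivial. -/
def IsInjectiveOn (D : H →ₗ.[ℂ] H) (P : H →L[ℂ] H) : Prop :=
  ∀ ξ : D.domain, P ξ = ξ → D ξ = 0 → (ξ : H) = 0

/-- The ⋆-subalgebra `ℰ` of `E` generated by the differentiable compacts `𝒞(P H)` and by the
compressions `P a P`, `a ∈ 𝒜`. -/
def smoothAlg {A E : Type*} [CStarAlgebra A] [CStarAlgebra E] (𝒜 : NonUnitalStarSubalgebra ℂ A)
    (πA : A →⋆ₐ[ℂ] (H →L[ℂ] H)) (D : H →ₗ.[ℂ] H) (P : H →L[ℂ] H)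
    (π : E →⋆ₙₐ[ℂ] (H →L[ℂ] H)) : NonUnitalStarSubalgebra ℂ E :=
  NonUnitalStarAlgebra.adjoin ℂ
    ({e : E | IsDiffCompact D (π e) ∧ P * π e * P = π e} ∪
      {e : E | ∃ a ∈ 𝒜, π e = P * πA a * P})

end Operators

/-! ## Operators on `H ⊗ ℂ⁶` -/

section Matrices

variable {H : Type*} [NormedAddCommGroup H] [InnerProductSpace ℂ H]

/-- The Hilbert space `H ⊗ ℂⁿ`, as the `ℓ²`-sum of `n` copies of `H`. -/
abbrev Amp (n : ℕ) (H : Type*) : Type _ := PiLp 2 (fun _ : Fin n => H)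

/-- The diagonal operator `x₁ ⊕ ⋯ ⊕ xₙ` on `H ⊗ ℂⁿ`. -/
def diagOp {n : ℕ} (x : Fin n → (H →L[ℂ] H)) : Amp n H →L[ℂ] Amp n H :=
  ((PiLp.continuousLinearEquiv 2 ℂ (fun _ : Fin n => H)).symm :
      (Fin n → H) →L[ℂ] Amp n H).comp
    (ContinuousLinearMap.pi fun i => (x i).comp (PiLp.proj 2 (fun _ : Fin n => H) i))

@[simp] theorem diagOp_apply {n : ℕ} (x : Fin n → (H →L[ℂ] H)) (v : Amp n H) (i : Fin n) :
    diagOp x v i = x i (v i) := rfl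

/-- The direct sum `ρ₁ ⊕ ⋯ ⊕ ρₙ` of representations on `H`, as a representation on `H ⊗ ℂⁿ`. -/
def diagRep [CompleteSpace H] {E : Type*} [NonUnitalCStarAlgebra E] {n : ℕ}
    (ρ : Fin n → (E →⋆ₙₐ[ℂ] (H →L[ℂ] H))) : E →⋆ₙₐ[ℂ] (Amp n H →L[ℂ] Amp n H) where
  toFun e := diagOp fun i => ρ i e
  map_smul' c e := by ext v i; simp
  map_zero' := by ext v i; simp
  map_add' e f := by ext v i; simp
  map_mul' e f := by ext v i; simp
  map_star' e := by
    rw [ContinuousLinearMap.star_eq_adjoint, ContinuousLinearMap.eq_adjoint_iff]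
    intro v w
    simp [PiLp.inner_apply, map_star, ContinuousLinearMap.star_eq_adjoint,
      ContinuousLinearMap.adjoint_inner_left]

/-- For an unbounded operator `D` on `H` and an `n × n` matrix `M` of bounded operators on `H`, the
operator on `H ⊗ ℂⁿ` with domain `dom D ⊗ ℂⁿ` and with matrix entries `M i j D`. -/
def matOp {n : ℕ} (M : Matrix (Fin n) (Fin n) (H →L[ℂ] H)) (D : H →ₗ.[ℂ] H) :
    Amp n H →ₗ.[ℂ] Amp n H where
  domain :=
    { carrier := {v | ∀ i, v i ∈ D.domain}
      add_mem' := fun hv hw i => D.domain.add_mem (hv i) (hw i)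
      zero_mem' := fun _ => D.domain.zero_mem
      smul_mem' := fun c _ hv i => D.domain.smul_mem c (hv i) }
  toFun :=
    { toFun := fun v => WithLp.toLp 2 fun i => ∑ j, M i j (D ⟨v.1 j, v.2 j⟩)
      map_add' := fun v w => by
        ext i
        have h : ∀ j, D ⟨(v + w).1 j, (v + w).2 j⟩ = D ⟨v.1 j, v.2 j⟩ + D ⟨w.1 j, w.2 j⟩ :=
          fun j => by rw [← D.map_add]; rfl
        simp only [h, map_add, Finset.sum_add_distrib, PiLp.add_apply]
      map_smul' := fun c v => by
        ext i
        have h : ∀ j, D ⟨(c • v).1 j, (c • v).2 j⟩ = c • D ⟨v.1 j, v.2 j⟩ :=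
          fun j => by rw [← D.map_smul]; rfl
        simp only [h, map_smul, Finset.smul_sum, PiLp.smul_apply, RingHom.id_apply] }

theorem matOp_apply {n : ℕ} (M : Matrix (Fin n) (Fin n) (H →L[ℂ] H)) (D : H →ₗ.[ℂ] H)
    (v : (matOp M D).domain) (i : Fin n) :
    matOp M D v i = ∑ j, M i j (D ⟨v.1 j, v.2 j⟩) := rfl

variable [CompleteSpace H] {A E : Type*} [CStarAlgebra A] [CStarAlgebra E]

/-- The representation `Π = π_σ ⊕ π_σ ⊕ π ⊕ π_σ ⊕ π ⊕ π_σ` of `E` on `H ⊗ ℂ⁶`, with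
`π_σ = πA ∘ σ`. -/
def extRep (πA : A →⋆ₐ[ℂ] (H →L[ℂ] H)) (σ : E →⋆ₐ[ℂ] A) (π : E →⋆ₙₐ[ℂ] (H →L[ℂ] H)) :
    E →⋆ₙₐ[ℂ] (Amp 6 H →L[ℂ] Amp 6 H) :=
  let πσ : E →⋆ₙₐ[ℂ] (H →L[ℂ] H) := (πA.comp σ).toNonUnitalStarAlgHom
  diagRep ![πσ, πσ, π, πσ, π, πσ]

/-- The Dirac operator on `H ⊗ ℂ⁶`, with domain `dom D ⊗ ℂ⁶`. In terms of `Dᵖ = P D` and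
`D^q = (1 - P) D`, its matrix is `D ⊕ (-D) ⊕ [[0, T], [T, 0]]` with
`T = [[D^q, Dᵖ], [Dᵖ, s D^q]]`, where `s` is a sign. -/
def extDirac (s : ℤˣ) (D : H →ₗ.[ℂ] H) (P : H →L[ℂ] H) : Amp 6 H →ₗ.[ℂ] Amp 6 H :=
  let Q : H →L[ℂ] H := 1 - P
  matOp
    !![1,  0, 0, 0,     0, 0;
       0, -1, 0, 0,     0, 0;
       0,  0, 0, 0,     Q, P;
       0,  0, 0, 0,     P, (s : ℤ) • Q;
       0,  0, Q, P,     0, 0;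
       0,  0, P, (s : ℤ) • Q, 0, 0] D

end Matrices

end ToeplitzExt

end

open scoped ENNReal ComplexOrder InnerProductSpace

noncomputable section

set_option linter.unusedSectionVars false

namespace ToeplitzExt

/-! ### Self-adjoint operators, bounded commutators and `(I + D²)⁻¹`. -/

section Operators

variable {H : Type*} [NormedAddCommGroup H] [InnerProductSpace ℂ H] [CompleteSpace H]
  {D : H →ₗ.[ℂ] H}

/-! The new operator is `M D` for the matrix `M = extMat s P`, whose entries are `0`, `1`, `P` and
`1 - P` up to sign. The entries commute with `D`, `M` is self-adjoint and `M² = 1`, so `(M D)² = D²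
⊗ 1` and `(I + (M D)²)⁻¹ = R ⊗ 1` (`isInvOneAddSq_matOp`). This identity yields self-adjointness,
since a symmetric operator `T` with `I + T²` onto is self-adjoint. It also yields compactness of the
resolvent and the spectral dimension: amplification repeats every singular value six times, which
does not affect `O(log N)` (`inDixmierClass_diagOp_iff`).

Write `a = πA (σ e)` and `y = π e`. The summands of the representation are arranged so that, apart
from `[D, a]` and `[D, y]`, the commutator involves only `(P a - y) D`, `(y - a P) D` and `[P, a] D`
(`extMat_commutator_induction`). For `y = P a P` these are pieces of `[P, a] D`; for a
differentiable compact `y` one has `a = 0` and they are `± y D` or `0`. So the commutators are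
bounded on generators, hence on the algebra they generate (`smoothAlg_le`).

For the metric condition, write `π e = P a P + k` and let `T` be the commutator with `e`. One entry
of `T` is `[D, a]`, and comparing it with another shows that `k D` is bounded by `2‖T‖` on `P H`
(`norm_compact_part_apply_le`). If `W` is the compact inverse of `D²` on `P H`, then `‖k x‖² ≤
(2‖T‖)² ‖x‖ ‖W x‖`, and likewise for the adjoint of `k`. Such `k` form a totally bounded set
(`totallyBounded_of_le_compact`), the part `a` is covered by the metric condition on `A`, and `π` is
isometric. -/

theorem inner_map_symm (hD : IsSelfAdjoint D) (x y : D.domain) :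
    ⟪D x, (y : H)⟫_ℂ = ⟪(x : H), D y⟫_ℂ := by
  have h := LinearPMap.adjoint_isFormalAdjoint hD.dense_domain
  rw [LinearPMap.isSelfAdjoint_def.1 hD] at h
  exact h x y

theorem mem_domain_of_inner (hD : IsSelfAdjoint D) {x w : H}
    (h : ∀ y : D.domain, ⟪w, (y : H)⟫_ℂ = ⟪x, D y⟫_ℂ) : ∃ hx : x ∈ D.domain, D ⟨x, hx⟩ = w := by
  have hx := LinearPMap.mem_adjoint_domain_of_exists x ⟨w, h⟩
  have hw := LinearPMap.adjoint_apply_eq hD.dense_domain ⟨x, hx⟩ h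
  -- The equality `D.adjoint = D` is substituted for a variable `T`, because membership in the
  -- domain depends on the operator.
  have key : ∀ T : H →ₗ.[ℂ] H, T = D → ∀ hx : x ∈ T.domain, T ⟨x, hx⟩ = w →
      ∃ hx : x ∈ D.domain, D ⟨x, hx⟩ = w := by
    rintro T rfl hx hw
    exact ⟨hx, hw⟩
  exact key _ (LinearPMap.isSelfAdjoint_def.1 hD) hx hw

/-- A symmetric operator for which `I + T²` is surjective is self-adjoint. -/
theorem isSelfAdjoint_of_isInvOneAddSq {R : H →L[ℂ] H} (hd : Dense (D.domain : Set H))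
    (hs : ∀ x y : D.domain, ⟪D x, (y : H)⟫_ℂ = ⟪(x : H), D y⟫_ℂ) (hR : IsInvOneAddSq D R) :
    IsSelfAdjoint D := by
  have hle : D ≤ D.adjoint := by
    refine LinearPMap.IsFormalAdjoint.le_adjoint hd ?_
    exact fun x y => hs x y
  have hadj := LinearPMap.adjoint_isFormalAdjoint hd
  -- `D + i` and `D - i` are onto
  have hsurj : ∀ (c : ℂ), c * c = -1 → ∀ ξ : H, ∃ x : D.domain, D x + c • (x : H) = ξ := by
    intro c hc ξ
    obtain ⟨h, h', hξ⟩ := hR.right_inv ξ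
    -- The factorization `(D + c)(D - c) = D² + 1` for `c² = -1` makes `(D - c) R ξ` a preimage.
    refine ⟨⟨D ⟨R ξ, h⟩, h'⟩ - c • ⟨R ξ, h⟩, ?_⟩
    rw [D.map_sub, D.map_smul]
    simp only [Submodule.coe_sub, Submodule.coe_smul, smul_sub, smul_smul, hc]
    rw [neg_smul, one_smul, sub_neg_eq_add, ← add_assoc, sub_add_cancel, add_comm]
    exact hξ
  have hdom : D.adjoint.domain ≤ D.domain := by
    intro w hw
    obtain ⟨x, hx⟩ := hsurj Complex.I Complex.I_mul_I (D.adjoint ⟨w, hw⟩ + Complex.I • w)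
    obtain ⟨hxm, hxe⟩ : ∃ hx' : (x : H) ∈ D.adjoint.domain, D x = D.adjoint ⟨x, hx'⟩ :=
      ⟨hle.1 x.2, hle.2 rfl⟩
    -- `w - x` lies in the kernel of `D.adjoint + i`, which is orthogonal to the range of `D - i`,
    -- and that range is everything.
    have hz : w - x = 0 := by
      obtain ⟨y, hy⟩ := hsurj (-Complex.I) (by simp) (w - x)
      have h1 := hadj ⟨w, hw⟩ y
      have h2 := hadj ⟨x, hxm⟩ y
      rw [hxe] at hx
      have h3 : D.adjoint ⟨w, hw⟩ - D.adjoint ⟨x, hxm⟩ = -Complex.I • (w - x) := by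
        have : D.adjoint ⟨w, hw⟩ = D.adjoint ⟨x, hxm⟩ + Complex.I • (x : H) - Complex.I • w := by
          rw [hx]; abel
        rw [this]; simp only [neg_smul, smul_sub]; abel
      rw [← inner_self_eq_zero (𝕜 := ℂ)]
      nth_rewrite 2 [← hy]
      rw [inner_add_right, inner_smul_right]
      have h4 : ⟪w - x, D y⟫_ℂ = ⟪-Complex.I • (w - (x : H)), (y : H)⟫_ℂ := by
        rw [← h3, inner_sub_left, inner_sub_left]
        exact congrArg₂ _ h1.symm h2.symm
      rw [h4, inner_smul_left]
      simp
    rw [sub_eq_zero.1 hz]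
    exact x.2
  exact LinearPMap.isSelfAdjoint_def.2 (LinearPMap.eq_of_le_of_domain_eq hle
    (le_antisymm hle.1 hdom)).symm

/-! ### Bounded commutators -/

namespace HasCommutator

variable {x y S T : H →L[ℂ] H}

theorem mem_domain (h : HasCommutator D x T) (ξ : D.domain) : x ξ ∈ D.domain := (h ξ).1

theorem apply (h : HasCommutator D x T) (ξ : D.domain) :
    D ⟨x ξ, h.mem_domain ξ⟩ = x (D ξ) + T ξ := by
  obtain ⟨_, h'⟩ := h ξ
  rw [← h']; abel

theorem of_apply (h : ∀ ξ : D.domain, ∃ h : x ξ ∈ D.domain, D ⟨x ξ, h⟩ = x (D ξ) + T ξ) :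
    HasCommutator D x T := fun ξ => by
  obtain ⟨h1, h2⟩ := h ξ
  exact ⟨h1, by rw [h2]; abel⟩

theorem unique (hd : Dense (D.domain : Set H)) (h : HasCommutator D x S)
    (h' : HasCommutator D x T) : S = T := by
  refine ContinuousLinearMap.ext fun v => congrFun (Continuous.ext_on hd S.continuous T.continuous
    fun ξ hξ => ?_) v
  have h1 := h.apply ⟨ξ, hξ⟩
  have h2 := h'.apply ⟨ξ, hξ⟩
  rw [h1] at h2
  exact add_left_cancel h2

theorem add (h : HasCommutator D x S) (h' : HasCommutator D y T) :
    HasCommutator D (x + y) (S + T) := of_apply fun ξ => by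
  refine ⟨D.domain.add_mem (h.mem_domain ξ) (h'.mem_domain ξ), ?_⟩
  have := D.map_add ⟨x ξ, h.mem_domain ξ⟩ ⟨y ξ, h'.mem_domain ξ⟩
  rw [h.apply, h'.apply] at this
  refine Eq.trans this ?_
  simp only [add_apply]
  abel

theorem smul (c : ℂ) (h : HasCommutator D x S) : HasCommutator D (c • x) (c • S) :=
  of_apply fun ξ => by
    refine ⟨D.domain.smul_mem c (h.mem_domain ξ), ?_⟩
    have := D.map_smul c ⟨x ξ, h.mem_domain ξ⟩
    rw [h.apply] at this
    refine Eq.trans this ?_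
    simp

theorem zero : HasCommutator D 0 0 := of_apply fun ξ => by
  refine ⟨D.domain.zero_mem, ?_⟩
  exact D.map_zero.trans (by simp)

theorem one : HasCommutator D 1 0 := of_apply fun ξ => ⟨ξ.2, by simp⟩

theorem mul (h : HasCommutator D x S) (h' : HasCommutator D y T) :
    HasCommutator D (x * y) (x * T + S * y) := of_apply fun ξ => by
  refine ⟨h.mem_domain ⟨y ξ, h'.mem_domain ξ⟩, ?_⟩
  have := h.apply ⟨y ξ, h'.mem_domain ξ⟩
  rw [h'.apply] at this
  refine Eq.trans this ?_
  simp [add_assoc]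

theorem star (hD : IsSelfAdjoint D) (h : HasCommutator D x T) :
    HasCommutator D (star x) (-star T) := of_apply fun ξ => by
  apply mem_domain_of_inner hD
  intro η
  simp only [ContinuousLinearMap.star_eq_adjoint, neg_apply, inner_add_left,
    inner_neg_left, ContinuousLinearMap.adjoint_inner_left]
  rw [inner_map_symm hD ξ ⟨x η, h.mem_domain η⟩, h.apply, inner_add_right]
  simp

end HasCommutator

theorem commNorm_le {x T : H →L[ℂ] H} (h : HasCommutator D x T) : commNorm D x ≤ ‖T‖ₑ :=
  iInf₂_le T h

theorem commNorm_eq (hd : Dense (D.domain : Set H)) {x T : H →L[ℂ] H} (h : HasCommutator D x T) :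
    commNorm D x = ‖T‖ₑ :=
  le_antisymm (commNorm_le h) (le_iInf₂ fun S hS => by rw [hS.unique hd h])

theorem commNorm_le_one_iff (hd : Dense (D.domain : Set H)) {x : H →L[ℂ] H} :
    commNorm D x ≤ 1 ↔ ∃ T, HasCommutator D x T ∧ ‖T‖ ≤ 1 := by
  have key : ∀ T : H →L[ℂ] H, ‖T‖ₑ ≤ 1 ↔ ‖T‖ ≤ 1 := fun T => by
    rw [← ofReal_norm, ENNReal.ofReal_le_one]
  constructor
  · intro h
    by_cases hT : ∃ T, HasCommutator D x T
    · obtain ⟨T, hT⟩ := hT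
      rw [commNorm_eq hd hT, key] at h
      exact ⟨T, hT, h⟩
    · exfalso
      -- Without a bounded extension the infimum runs over the empty set.
      have : commNorm D x = ⊤ := by
        simp only [commNorm, iInf_eq_top]
        exact fun T h => (hT ⟨T, h⟩).elim
      simp [this] at h
  · rintro ⟨T, hT, h⟩
    exact (commNorm_le hT).trans ((key T).2 h)

theorem commNorm_star_le (hD : IsSelfAdjoint D) {x : H →L[ℂ] H} (h : commNorm D x ≤ 1) :
    commNorm D (star x) ≤ 1 := by
  rw [commNorm_le_one_iff hD.dense_domain] at h ⊢
  obtain ⟨T, hT, h⟩ := h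
  exact ⟨_, hT.star hD, by rwa [norm_neg, norm_star]⟩

theorem hasCommutator_zero_of_commNorm_eq_zero (hd : Dense (D.domain : Set H)) {x : H →L[ℂ] H}
    (h : commNorm D x = 0) : HasCommutator D x 0 := by
  obtain ⟨T, hT, -⟩ := (commNorm_le_one_iff hd).1 (h.le.trans zero_le_one)
  rw [commNorm_eq hd hT, enorm_eq_zero] at h
  rwa [h] at hT

/-! ### The operator `(I + D²)⁻¹` -/

namespace IsInvOneAddSq

variable {R S P : H →L[ℂ] H}

theorem unique (h : IsInvOneAddSq D R) (h' : IsInvOneAddSq D S) : R = S := by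
  ext ξ
  obtain ⟨h1, h2, h3⟩ := h'.right_inv ξ
  have := h.left_inv ⟨S ξ, h1⟩ h2
  exact (congrArg R h3.symm).trans this

theorem mem_domain (h : IsInvOneAddSq D R) (ξ : H) : R ξ ∈ D.domain := (h.right_inv ξ).1

theorem map_mem_domain (h : IsInvOneAddSq D R) (ξ : H) : D ⟨R ξ, h.mem_domain ξ⟩ ∈ D.domain :=
  (h.right_inv ξ).2.1

theorem sq_apply (h : IsInvOneAddSq D R) (ξ : H) :
    D ⟨D ⟨R ξ, h.mem_domain ξ⟩, h.map_mem_domain ξ⟩ = ξ - R ξ :=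
  eq_sub_of_add_eq' (h.right_inv ξ).2.2

theorem isSelfAdjoint (hD : IsSelfAdjoint D) (h : IsInvOneAddSq D R) : IsSelfAdjoint R := by
  rw [ContinuousLinearMap.isSelfAdjoint_iff_isSymmetric]
  intro x y
  simp only [ContinuousLinearMap.coe_coe]
  have h1 := h.sq_apply x
  have h2 := h.sq_apply y
  have e1 : x = R x + D ⟨D ⟨R x, h.mem_domain x⟩, h.map_mem_domain x⟩ := by rw [h1]; abel
  have e2 : y = R y + D ⟨D ⟨R y, h.mem_domain y⟩, h.map_mem_domain y⟩ := by rw [h2]; abel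
  have e3 : ⟪R x, D ⟨D ⟨R y, h.mem_domain y⟩, h.map_mem_domain y⟩⟫_ℂ
      = ⟪D ⟨D ⟨R x, h.mem_domain x⟩, h.map_mem_domain x⟩, R y⟫_ℂ := by
    rw [← inner_map_symm hD ⟨R x, h.mem_domain x⟩,
      inner_map_symm hD _ ⟨R y, h.mem_domain y⟩]
  calc ⟪R x, y⟫_ℂ = ⟪R x, R y + D ⟨D ⟨R y, h.mem_domain y⟩, h.map_mem_domain y⟩⟫_ℂ := by rw [← e2]
    _ = ⟪R x + D ⟨D ⟨R x, h.mem_domain x⟩, h.map_mem_domain x⟩, R y⟫_ℂ := by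
      rw [inner_add_right, inner_add_left, e3]
    _ = ⟪x, R y⟫_ℂ := by rw [← e1]

/-- `P` commutes with `D²`, so `P (R ξ)` solves `(I + D²) η = P ξ`; the left inverse property
identifies it with `R (P ξ)`. -/
theorem commute (h : IsInvOneAddSq D R) (hP : HasCommutator D P 0) : Commute R P := by
  have hc : ∀ ξ : D.domain, D ⟨P ξ, hP.mem_domain ξ⟩ = P (D ξ) := fun ξ => by
    rw [hP.apply]; simp
  ext ξ
  change R (P ξ) = P (R ξ)
  have h1 := hc ⟨R ξ, h.mem_domain ξ⟩
  have h2 := hc ⟨D ⟨R ξ, h.mem_domain ξ⟩, h.map_mem_domain ξ⟩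
  have h3 : D ⟨P (R ξ), hP.mem_domain ⟨R ξ, h.mem_domain ξ⟩⟩ ∈ D.domain := by
    rw [h1]
    exact hP.mem_domain ⟨D ⟨R ξ, h.mem_domain ξ⟩, h.map_mem_domain ξ⟩
  have h4 : D ⟨D ⟨P (R ξ), hP.mem_domain ⟨R ξ, h.mem_domain ξ⟩⟩, h3⟩ = P (ξ - R ξ) := by
    rw [← h.sq_apply, ← h2]
    congr 2
  have h5 := h.left_inv ⟨P (R ξ), hP.mem_domain ⟨R ξ, h.mem_domain ξ⟩⟩ h3
  rw [h4, map_sub P, add_sub_cancel] at h5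
  exact h5

end IsInvOneAddSq

end Operators

/-! ### Compact operators: approximation, total boundedness, inverting `D²` on `P H`. -/

section Compact

variable {H : Type*} [NormedAddCommGroup H] [InnerProductSpace ℂ H] [CompleteSpace H]

theorem opNorm_le_of_sq_le {T : H →L[ℂ] H} {c : ℝ} (h : ∀ x, ‖T x‖ ^ 2 ≤ c * ‖x‖ ^ 2) :
    ‖T‖ ≤ √c := by
  refine T.opNorm_le_bound (Real.sqrt_nonneg c) fun x => ?_
  rw [← Real.sqrt_sq (norm_nonneg (T x)), ← Real.sqrt_sq (norm_nonneg x),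
    ← Real.sqrt_mul' c (sq_nonneg _)]
  exact Real.sqrt_le_sqrt (h x)

/-- `V` is spanned by a finite `ε`-net of the image of the unit ball; the orthogonal projection
approximates at least as well as the net. -/
theorem exists_norm_sub_starProjection_mul_le {B : H →L[ℂ] H} (hB : IsCompactOperator B) {ε : ℝ}
    (hε : 0 < ε) : ∃ (V : Submodule ℂ H) (_ : FiniteDimensional ℂ V),
      ‖B - V.starProjection * B‖ ≤ ε := by
  obtain ⟨K, hK, hBK⟩ := hB.image_closedBall_subset_compact (f := (B : H →ₗ[ℂ] H)) 1
  obtain ⟨t, ht, htK⟩ := Metric.totallyBounded_iff.1 (hK.totallyBounded.subset hBK) ε hε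
  have hfin : FiniteDimensional ℂ (Submodule.span ℂ t) := FiniteDimensional.span_of_finite ℂ ht
  refine ⟨Submodule.span ℂ t, hfin, ?_⟩
  refine ContinuousLinearMap.opNorm_le_of_unit_norm hε.le fun x hx => ?_
  obtain ⟨y, hy, hxy⟩ := Set.mem_iUnion₂.1
    (htK ⟨x, by simp [hx], rfl⟩ : (B x) ∈ ⋃ y ∈ t, Metric.ball y ε)
  rw [Metric.mem_ball, dist_eq_norm] at hxy
  refine le_trans ?_ hxy.le
  change ‖B x - (Submodule.span ℂ t).starProjection (B x)‖ ≤ _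
  rw [Submodule.starProjection_minimal]
  exact ciInf_le (f := fun w : Submodule.span ℂ t => ‖B x - w‖)
    ⟨0, by rintro _ ⟨w, rfl⟩; exact norm_nonneg _⟩ ⟨y, Submodule.subset_span hy⟩

theorem totallyBounded_of_approx {α : Type*} [PseudoMetricSpace α] {s : Set α}
    (h : ∀ ε > 0, ∃ t : Set α, TotallyBounded t ∧ ∀ x ∈ s, ∃ y ∈ t, dist x y ≤ ε) :
    TotallyBounded s := by
  rw [Metric.totallyBounded_iff]
  intro ε hε
  obtain ⟨t, ht, hst⟩ := h (ε / 2) (half_pos hε)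
  obtain ⟨u, hu, htu⟩ := Metric.totallyBounded_iff.1 ht (ε / 2) (half_pos hε)
  refine ⟨u, hu, fun x hx => ?_⟩
  obtain ⟨y, hy, hxy⟩ := hst x hx
  obtain ⟨z, hz, hyz⟩ := Set.mem_iUnion₂.1 (htu hy)
  refine Set.mem_iUnion₂.2 ⟨z, hz, ?_⟩
  rw [Metric.mem_ball] at hyz ⊢
  linarith [dist_triangle x y z]

theorem totallyBounded_image_closedBall {G K : Type*} [NormedAddCommGroup G] [NormedSpace ℂ G]
    [FiniteDimensional ℂ G] [NormedAddCommGroup K] [NormedSpace ℂ K] (φ : G →L[ℂ] K) (c : ℝ) :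
    TotallyBounded (φ '' {x | ‖x‖ ≤ c}) := by
  have : ProperSpace G := FiniteDimensional.proper ℂ G
  refine TotallyBounded.subset (Set.image_mono fun x hx => ?_)
    ((isCompact_closedBall (0 : G) c).totallyBounded.image φ.uniformContinuous)
  simpa using hx

/-- The corner factors through the finite-dimensional space of operators on `V`, where balls are
totally bounded. -/
theorem totallyBounded_corner (V : Submodule ℂ H) [FiniteDimensional ℂ V] (c : ℝ) :
    TotallyBounded ((fun k : H →L[ℂ] H => V.starProjection * k * V.starProjection) ''
      {k | ‖k‖ ≤ c}) := by
  let φ : (V →L[ℂ] V) →L[ℂ] (H →L[ℂ] H) :=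
    (ContinuousLinearMap.precomp H V.orthogonalProjectionOnto).comp
      (ContinuousLinearMap.postcomp V V.subtypeL)
  refine (totallyBounded_image_closedBall (G := V →L[ℂ] V) (K := H →L[ℂ] H) φ c).subset ?_
  rintro _ ⟨k, hk, rfl⟩
  refine ⟨V.orthogonalProjectionOnto ∘L k ∘L V.subtypeL, ?_, by ext; rfl⟩
  have h1 := ContinuousLinearMap.opNorm_comp_le V.orthogonalProjectionOnto (k ∘L V.subtypeL)
  have h2 := ContinuousLinearMap.opNorm_comp_le k V.subtypeL
  have h3 := V.orthogonalProjectionOnto_norm_le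
  have h4 := V.norm_subtypeL_le
  have hk' : ‖k‖ ≤ c := hk
  calc ‖_‖ ≤ _ := h1
    _ ≤ 1 * (‖k‖ * 1) := by gcongr; exact h2.trans (by gcongr)
    _ ≤ c := by simpa

/-- Operators that are controlled, together with their adjoints, by a compact operator form a
totally bounded set. -/
theorem totallyBounded_of_le_compact {W : H →L[ℂ] H} (hW : IsCompactOperator W)
    (hsa : IsSelfAdjoint W) {c : ℝ} (hc : 0 ≤ c) :
    TotallyBounded {k : H →L[ℂ] H | (∀ x, ‖k x‖ ^ 2 ≤ c * (‖x‖ * ‖W x‖)) ∧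
      ∀ x, ‖star k x‖ ^ 2 ≤ c * (‖x‖ * ‖W x‖)} := by
  refine totallyBounded_of_approx fun ε hε => ?_
  -- Cutting `k` down on either side costs `√(c * δ)`, hence the factor 2; dividing by `c + 1` keeps
  -- `c = 0` harmless.
  obtain ⟨δ, hδ, hδε⟩ : ∃ δ > 0, 2 * √(c * δ) ≤ ε := by
    refine ⟨(ε / 2) ^ 2 / (c + 1), by positivity, ?_⟩
    have : √(c * ((ε / 2) ^ 2 / (c + 1))) ≤ ε / 2 := by
      rw [Real.sqrt_le_left (by positivity), mul_div_left_comm]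
      refine mul_le_of_le_one_right (by positivity) ?_
      rw [div_le_one (by positivity)]
      linarith
    linarith
  obtain ⟨V, hV, hVW⟩ := exists_norm_sub_starProjection_mul_le hW hδ
  set F := V.starProjection with hF
  have hFsa : star F = F := isSelfAdjoint_starProjection V
  have hWF : ‖W - W * F‖ ≤ δ := by
    rw [← norm_star, star_sub, star_mul, hFsa, hsa.star_eq]
    exact hVW
  have hF1 : ‖1 - F‖ ≤ 1 := by
    have : (1 - F : H →L[ℂ] H) = Vᗮ.starProjection := by
      rw [Submodule.starProjection_orthogonal']
    rw [this]
    exact Submodule.starProjection_norm_le _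
  have key : ∀ k : H →L[ℂ] H, (∀ x, ‖k x‖ ^ 2 ≤ c * (‖x‖ * ‖W x‖)) →
      ‖k - k * F‖ ≤ √(c * δ) := by
    intro k hk
    refine opNorm_le_of_sq_le fun x => ?_
    have h1 := hk ((1 - F) x)
    have h2 : ‖(1 - F) x‖ ≤ ‖x‖ :=
      ((1 - F).le_opNorm x).trans (mul_le_of_le_one_left (norm_nonneg x) hF1)
    have h3 : ‖W ((1 - F) x)‖ ≤ δ * ‖x‖ := by
      have : W ((1 - F) x) = (W - W * F) x := by simp
      rw [this]
      exact ((W - W * F).le_opNorm x).trans (by gcongr)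
    have h4 : (k - k * F) x = k ((1 - F) x) := by simp
    rw [h4]
    calc _ ≤ _ := h1
      _ ≤ c * (‖x‖ * (δ * ‖x‖)) := by gcongr
      _ = _ := by ring
  refine ⟨_, totallyBounded_corner V (√(c * ‖W‖)), ?_⟩
  rintro k ⟨h1, h2⟩
  refine ⟨F * k * F, ⟨k, opNorm_le_of_sq_le fun x => ?_, rfl⟩, ?_⟩
  · refine (h1 x).trans ?_
    rw [mul_assoc]
    have := W.le_opNorm x
    calc _ ≤ c * (‖x‖ * (‖W‖ * ‖x‖)) := by gcongr
      _ = _ := by ring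
  · rw [dist_eq_norm]
    -- The left cut is controlled by the hypothesis on `star k`, the right cut by the one on `k`.
    have e1 : k - F * k * F = (k - F * k) + F * (k - k * F) := by noncomm_ring
    have e2 : ‖k - F * k‖ ≤ √(c * δ) := by
      have := key _ h2
      rwa [← norm_star, star_sub, star_mul, star_star, hFsa] at this
    have e3 : ‖F‖ ≤ 1 := Submodule.starProjection_norm_le _
    rw [e1]
    calc _ ≤ ‖k - F * k‖ + ‖F * (k - k * F)‖ := norm_add_le _ _
      _ ≤ √(c * δ) + 1 * √(c * δ) := by
        gcongr
        exact (norm_mul_le _ _).trans (by gcongr; exact key k h1)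
      _ ≤ ε := by linarith

/-- By polarization `4⟪y, T x⟫` is a combination of four quadratic values. By the parallelogram law
their squared norms sum to 8 for unit vectors, hence the factor `8 / 4 = 2`. -/
theorem norm_le_of_numericalRange {T : H →L[ℂ] H} {r : ℝ}
    (h : ∀ x : H, ‖x‖ = 1 → ‖⟪x, T x⟫_ℂ‖ ≤ r) (hr : 0 ≤ r) : ‖T‖ ≤ 2 * r := by
  have hq : ∀ x : H, ‖⟪x, T x⟫_ℂ‖ ≤ r * ‖x‖ ^ 2 := by
    intro x
    rcases eq_or_ne x 0 with rfl | hx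
    · simp
    have hx' : ‖x‖ ≠ 0 := norm_ne_zero_iff.2 hx
    have := h ((‖x‖⁻¹ : ℂ) • x) (by simp [norm_smul, hx'])
    rw [map_smul, inner_smul_left, inner_smul_right] at this
    simp only [norm_mul, RCLike.norm_conj, norm_inv, Complex.norm_real, norm_norm] at this
    have hpos : 0 < ‖x‖ := norm_pos_iff.2 hx
    rw [← mul_assoc, ← mul_inv, inv_mul_le_iff₀ (by positivity)] at this
    linarith
  have hpol : ∀ x y : H, ‖x‖ = 1 → ‖y‖ = 1 → ‖⟪y, T x⟫_ℂ‖ ≤ 2 * r := by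
    intro x y hx hy
    have hq' : ∀ z : H, ‖⟪T z, z⟫_ℂ‖ ≤ r * ‖z‖ ^ 2 := fun z => by
      rw [norm_inner_symm]; exact hq z
    have hp := inner_map_polarization' (T : H →ₗ[ℂ] H) x y
    have p1 := parallelogram_law_with_norm ℂ x y
    have p2 := parallelogram_law_with_norm ℂ x (Complex.I • y)
    rw [norm_smul, Complex.norm_I, one_mul] at p2
    rw [hx, hy] at p1 p2
    simp only [ContinuousLinearMap.coe_coe] at hp
    rw [norm_inner_symm, hp, norm_div, Complex.norm_ofNat, div_le_iff₀ (by norm_num)]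
    have q1 := hq' (x + y)
    have q2 := hq' (x - y)
    have q3 := hq' (x + Complex.I • y)
    have q4 := hq' (x - Complex.I • y)
    have n1 : ∀ a b c d : ℂ, ‖a - b - Complex.I * c + Complex.I * d‖ ≤ ‖a‖ + ‖b‖ + ‖c‖ + ‖d‖ := by
      intro a b c d
      have h1 := norm_add_le (a - b - Complex.I * c) (Complex.I * d)
      have h2 := norm_sub_le (a - b) (Complex.I * c)
      have h3 := norm_sub_le a b
      rw [norm_mul, Complex.norm_I, one_mul] at h1 h2
      linarith
    refine (n1 _ _ _ _).trans ?_
    nlinarith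
  refine ContinuousLinearMap.opNorm_le_of_unit_norm (by linarith) fun x hx => ?_
  rcases eq_or_ne (T x) 0 with h0 | h0
  · rw [h0, norm_zero]; linarith
  have := hpol x ((‖T x‖⁻¹ : ℂ) • T x) hx (by simp [norm_smul, h0])
  rw [inner_smul_left, inner_self_eq_norm_sq_to_K] at this
  have hne : ‖T x‖ ≠ 0 := norm_ne_zero_iff.2 h0
  simp only [norm_mul, RCLike.norm_conj, norm_inv, Complex.norm_real, norm_norm, norm_pow] at this
  simpa [sq, hne] using this

/-! ### Compact operators on the range of a projection -/

/-- The differentiable compact operators on `P H`. -/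
def diffCompactOn (D : H →ₗ.[ℂ] H) (P : H →L[ℂ] H) : Submodule ℂ (H →L[ℂ] H) where
  carrier := {y | IsDiffCompact D y ∧ P * y * P = y}
  zero_mem' := by
    refine ⟨⟨isCompactOperator_zero, fun ξ _ => D.domain.zero_mem, ⟨0, fun ξ => rfl⟩,
      ⟨0, fun ξ => ?_⟩⟩, by simp⟩
    exact D.map_zero
  add_mem' := by
    rintro x y ⟨hx, hx'⟩ ⟨hy, hy'⟩
    obtain ⟨S, hS⟩ := hx.bounded_right
    obtain ⟨T, hT⟩ := hx.bounded_left
    obtain ⟨S', hS'⟩ := hy.bounded_right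
    obtain ⟨T', hT'⟩ := hy.bounded_left
    refine ⟨⟨hx.compact.add hy.compact,
      fun ξ hξ => D.domain.add_mem (hx.map_domain ξ hξ) (hy.map_domain ξ hξ),
      ⟨S + S', fun ξ => by simp [hS, hS']⟩, ⟨T + T', fun ξ => ?_⟩⟩, by
        rw [mul_add, add_mul, hx', hy']⟩
    exact (D.map_add ⟨x ξ, hx.map_domain ξ ξ.2⟩ ⟨y ξ, hy.map_domain ξ ξ.2⟩).trans
      (by simp [hT, hT'])
  smul_mem' := by
    rintro c x ⟨hx, hx'⟩
    obtain ⟨S, hS⟩ := hx.bounded_right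
    obtain ⟨T, hT⟩ := hx.bounded_left
    refine ⟨⟨hx.compact.smul c, fun ξ hξ => D.domain.smul_mem c (hx.map_domain ξ hξ),
      ⟨c • S, fun ξ => by simp [hS]⟩, ⟨c • T, fun ξ => ?_⟩⟩, by
        rw [mul_smul_comm, smul_mul_assoc, hx']⟩
    exact (D.map_smul c ⟨x ξ, hx.map_domain ξ ξ.2⟩).trans (by simp [hT])

open InnerProductSpace in
theorem mul_rankOne_mul {P : H →L[ℂ] H} (hP : IsSelfAdjoint P) (x y : H) :
    P * rankOne ℂ x y * P = rankOne ℂ (P x) (P y) := by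
  ext z
  change P (⟪y, P z⟫_ℂ • x) = ⟪P y, z⟫_ℂ • P x
  rw [map_smul, ← ContinuousLinearMap.adjoint_inner_left, ← ContinuousLinearMap.star_eq_adjoint,
    hP.star_eq]

open InnerProductSpace in
theorem isCompactOperator_rankOne (x y : H) : IsCompactOperator (rankOne ℂ x y) := by
  rw [rankOne_def']
  have : IsCompactOperator (ContinuousLinearMap.toSpanSingleton ℂ x) :=
    isCompactOperator_of_locallyCompactSpace_rng _
  exact this.comp_clm (innerSL ℂ y)

-- Multiplication by `D` on either side of a rank one operator moves `D` onto one of its vectors, by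
-- symmetry of `D`.
open InnerProductSpace in
theorem rankOne_mem_diffCompactOn {D : H →ₗ.[ℂ] H} (hD : IsSelfAdjoint D) {P : H →L[ℂ] H}
    (hP : IsStarProjection P) (hc : HasCommutator D P 0) {x y : H} (hx : x ∈ D.domain)
    (hy : y ∈ D.domain) : rankOne ℂ (P x) (P y) ∈ diffCompactOn D P := by
  have hx' := hc.mem_domain ⟨x, hx⟩
  have hy' := hc.mem_domain ⟨y, hy⟩
  have hPP : ∀ z, P (P z) = P z := fun z => DFunLike.congr_fun hP.isIdempotentElem z
  refine ⟨⟨isCompactOperator_rankOne _ _, fun ξ _ => D.domain.smul_mem _ hx',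
    ⟨rankOne ℂ (P x) (D ⟨P y, hy'⟩), fun ξ => ?_⟩,
    ⟨rankOne ℂ (D ⟨P x, hx'⟩) (P y), fun ξ => ?_⟩⟩, ?_⟩
  · rw [rankOne_apply, rankOne_apply]
    congr 1
    exact (inner_map_symm hD ⟨P y, hy'⟩ ξ).symm
  · exact D.map_smul _ ⟨P x, hx'⟩
  · rw [mul_rankOne_mul hP.isSelfAdjoint, hPP, hPP]

open InnerProductSpace in
/-- The differentiable compact operators on `P H` are dense in the compact operators on `P H`. -/
theorem mem_closure_diffCompactOn {D : H →ₗ.[ℂ] H} (hD : IsSelfAdjoint D) {P : H →L[ℂ] H}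
    (hP : IsStarProjection P) (hc : HasCommutator D P 0) {k : H →L[ℂ] H} (hk : IsCompactOn P k) :
    k ∈ (diffCompactOn D P).topologicalClosure := by
  have h1 : ∀ x y : H, rankOne ℂ (P x) (P y) ∈ (diffCompactOn D P).topologicalClosure := by
    intro x y
    have hcont : Continuous fun p : H × H => rankOne ℂ (P p.1) (P p.2) := by
      simp only [rankOne_def']
      exact ((ContinuousLinearMap.toSpanSingletonCLE (𝕜 := ℂ) (E := H)).continuous.comp
        (P.continuous.comp continuous_fst)).clm_comp
        ((innerSL ℂ).continuous.comp (P.continuous.comp continuous_snd))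
    exact map_mem_closure₂ (f := fun x y => rankOne ℂ (P x) (P y)) hcont (hD.dense_domain x)
      (hD.dense_domain y) fun a ha b hb => rankOne_mem_diffCompactOn hD hP hc ha hb
  rw [← SetLike.mem_coe, ← (diffCompactOn D P).isClosed_topologicalClosure.closure_eq,
    Metric.mem_closure_iff]
  intro ε hε
  obtain ⟨V, hV, hVk⟩ := exists_norm_sub_starProjection_mul_le hk.1 (half_pos hε)
  -- Expanding the projection in an orthonormal basis of `V` turns this into a finite sum of rank
  -- one operators with vectors in `P H`.
  refine ⟨P * (V.starProjection * k) * P, ?_, ?_⟩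
  · rw [SetLike.mem_coe, (stdOrthonormalBasis ℂ V).starProjection_eq_sum_rankOne, Finset.sum_mul,
      Finset.mul_sum, Finset.sum_mul]
    refine Submodule.sum_mem _ fun i _ => ?_
    rw [ContinuousLinearMap.mul_def (rankOne ℂ _ _), rankOne_comp, mul_rankOne_mul hP.isSelfAdjoint]
    exact h1 _ _
  · rw [dist_eq_norm]
    nth_rewrite 1 [← hk.2]
    rw [← sub_mul, ← mul_sub]
    have hP1 : ‖P‖ ≤ 1 := hP.norm_le
    calc _ ≤ ‖P‖ * ‖k - V.starProjection * k‖ * ‖P‖ :=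
          (norm_mul_le _ _).trans (by gcongr; exact norm_mul_le _ _)
      _ ≤ 1 * (ε / 2) * 1 := by gcongr
      _ < ε := by linarith

/-- If `D` has compact resolvent and is injective on `P H`, then `D²` has a compact inverse on
`P H`. -/
theorem exists_compact_inverse_sq {D : H →ₗ.[ℂ] H} (hD : IsSelfAdjoint D) {P R : H →L[ℂ] H}
    (hP : IsStarProjection P) (hc : HasCommutator D P 0) (hR : IsInvOneAddSq D R)
    (hRc : IsCompactOperator R) (hinj : IsInjectiveOn D P) :
    ∃ W : H →L[ℂ] H, IsCompactOperator W ∧ IsSelfAdjoint W ∧ ∀ x, P (W x) = W x ∧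
      ∃ (h : W x ∈ D.domain) (h' : D ⟨W x, h⟩ ∈ D.domain), D ⟨D ⟨W x, h⟩, h'⟩ = P x := by
  have hPP : ∀ z, P (P z) = P z := fun z => DFunLike.congr_fun hP.isIdempotentElem z
  have hcomm : Commute R P := hR.commute hc
  have hcomm' : ∀ z, R (P z) = P (R z) := fun z => DFunLike.congr_fun hcomm.eq z
  -- Fredholm alternative: otherwise `R P` has eigenvalue 1, and an eigenvector `x` satisfies `P x =
  -- x` and `R x = x`. Then `D² x = 0`, so `D x = 0`, against injectivity.
  have hu : IsUnit (1 - R * P) := by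
    have hK : IsCompactOperator (R * P) := hRc.comp_clm P
    have := (IsCompactOperator.hasEigenvalue_or_mem_resolventSet hK
      (one_ne_zero (α := ℂ))).resolve_left ?_
    · simpa [spectrum.mem_resolventSet_iff] using this
    · intro h
      obtain ⟨x, hx⟩ := h.exists_hasEigenvector
      have hx1 : R (P x) = x := by simpa using hx.apply_eq_smul
      have hPx : P x = x := by
        rw [← hx1, hcomm', hPP]
      rw [hPx] at hx1
      have hdx : x ∈ D.domain := hx1 ▸ hR.mem_domain x
      obtain ⟨h1, h2, h3⟩ := hR.right_inv x
      have h4 : D ⟨D ⟨R x, h1⟩, h2⟩ = 0 := by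
        have := h3
        nth_rewrite 1 [hx1] at this
        exact add_eq_left.1 this
      have h5 : D ⟨R x, h1⟩ = 0 := by
        rw [← inner_self_eq_zero (𝕜 := ℂ)]
        refine (inner_map_symm hD ⟨R x, h1⟩ ⟨D ⟨R x, h1⟩, h2⟩).trans ?_
        rw [h4, inner_zero_right]
      have h6 := hinj ⟨R x, h1⟩ (by simp only [hx1, hPx]) h5
      exact hx.2 (hx1.symm.trans h6)
  -- On `P H` the inverse of `D² = R⁻¹ - 1` is `R (1 - R)⁻¹`; this is `R * G * P` with `G` the
  -- inverse of `1 - R * P`.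
  obtain ⟨G, hG⟩ := hu.exists_right_inv
  obtain ⟨G', hG'⟩ := hu.exists_left_inv
  have hGG : G' = G := left_inv_eq_right_inv hG' hG
  rw [hGG] at hG'
  have hGP : P * G = G * P := by
    have h1 : (1 - R * P) * P = P * (1 - R * P) := by
      rw [sub_mul, mul_sub, ← mul_assoc, ← hcomm.eq, one_mul, mul_one]
    calc P * G = G * ((1 - R * P) * P) * G := by
          rw [← mul_assoc, hG', one_mul]
      _ = G * P * ((1 - R * P) * G) := by rw [h1]; simp only [mul_assoc]
      _ = G * P := by rw [hG, mul_one]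
  have hGP' : ∀ z, P (G z) = G (P z) := fun z => DFunLike.congr_fun hGP z
  have hdom : ∀ x, R (G (P x)) ∈ D.domain := fun x => hR.mem_domain _
  have hsq : ∀ x, D ⟨D ⟨R (G (P x)), hdom x⟩, hR.map_mem_domain _⟩ = P x := by
    intro x
    rw [hR.sq_apply]
    have h1 : G (P x) - R (P (G (P x))) = P x := DFunLike.congr_fun hG (P x)
    rwa [hGP', hPP] at h1
  have hPW : ∀ x, P (R (G (P x))) = R (G (P x)) := fun x => by rw [← hcomm', hGP', hPP]
  refine ⟨R * G * P, (hRc.comp_clm (G * P) :), ?_,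
    fun x => ⟨hPW x, hdom x, hR.map_mem_domain _, hsq x⟩⟩
  rw [ContinuousLinearMap.isSelfAdjoint_iff_isSymmetric]
  intro x y
  change ⟪R (G (P x)), y⟫_ℂ = ⟪x, R (G (P y))⟫_ℂ
  have hPs : ∀ a b : H, ⟪P a, b⟫_ℂ = ⟪a, P b⟫_ℂ :=
    (ContinuousLinearMap.isSelfAdjoint_iff_isSymmetric.1 hP.isSelfAdjoint)
  calc ⟪R (G (P x)), y⟫_ℂ = ⟪R (G (P x)), P y⟫_ℂ := by rw [← hPs, hPW]
    _ = ⟪P x, R (G (P y))⟫_ℂ := by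
      refine (congrArg _ (hsq y)).symm.trans (Eq.trans ?_ (congrArg (⟪·, _⟫_ℂ) (hsq x)))
      refine (inner_map_symm hD ⟨R (G (P x)), hdom x⟩ ⟨_, hR.map_mem_domain _⟩).symm.trans ?_
      exact (inner_map_symm hD ⟨D ⟨R (G (P x)), hdom x⟩, hR.map_mem_domain _⟩
        ⟨R (G (P y)), hdom y⟩).symm
    _ = _ := by rw [hPs, hPW]

end Compact

/-! ### Matrices of operators on `H ⊗ ℂⁿ`. -/

section Amplification

variable {H : Type*} [NormedAddCommGroup H] [InnerProductSpace ℂ H] [CompleteSpace H] {n : ℕ}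
  {D : H →ₗ.[ℂ] H} {M : Matrix (Fin n) (Fin n) (H →L[ℂ] H)}

/-- The inclusion of the `j`-th summand of `H ⊗ ℂⁿ`. -/
def ampSingle (j : Fin n) : H →L[ℂ] Amp n H :=
  LinearMap.mkContinuous
    { toFun := fun ξ => WithLp.toLp 2 (Pi.single j ξ)
      map_add' := fun x y => by rw [Pi.single_add]; rfl
      map_smul' := fun c x => by rw [Pi.single_smul]; rfl } 1 fun ξ => by
        simp

theorem ampSingle_apply (j : Fin n) (ξ : H) (i : Fin n) :
    ampSingle j ξ i = if i = j then ξ else 0 := by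
  change (Pi.single j ξ : Fin n → H) i = _
  rw [Pi.single_apply]

@[simp] theorem norm_ampSingle_apply (j : Fin n) (ξ : H) : ‖ampSingle j ξ‖ = ‖ξ‖ :=
  PiLp.norm_single 2 (fun _ => H) j ξ

theorem sum_ampSingle (v : Amp n H) : ∑ j, ampSingle j (v j) = v := by
  ext i
  simp [ampSingle_apply]

/-- The bounded operator on `H ⊗ ℂⁿ` with matrix `T`. -/
def matBdd (T : Matrix (Fin n) (Fin n) (H →L[ℂ] H)) : Amp n H →L[ℂ] Amp n H :=
  ∑ i, ∑ j, ampSingle i ∘L T i j ∘L PiLp.proj 2 (fun _ : Fin n => H) j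

theorem matBdd_apply (T : Matrix (Fin n) (Fin n) (H →L[ℂ] H)) (v : Amp n H) (i : Fin n) :
    matBdd T v i = ∑ j, T i j (v j) := by
  simp [matBdd, ampSingle_apply]

theorem diagOp_ampSingle (x : Fin n → (H →L[ℂ] H)) (j : Fin n) (ξ : H) :
    diagOp x (ampSingle j ξ) = ampSingle j (x j ξ) := by
  ext i
  rw [diagOp_apply, ampSingle_apply, ampSingle_apply]
  split_ifs with h
  · rw [h]
  · simp

theorem isCompactOperator_diagOp {x : Fin n → (H →L[ℂ] H)} (hx : ∀ i, IsCompactOperator (x i)) :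
    IsCompactOperator (diagOp x) := by
  have h : diagOp x = ∑ i, ampSingle i ∘L x i ∘L PiLp.proj 2 (fun _ : Fin n => H) i := by
    ext v i
    simp [ampSingle_apply]
  rw [h]
  have : ∑ i, ampSingle i ∘L x i ∘L PiLp.proj 2 (fun _ : Fin n => H) i ∈
      compactOperator (RingHom.id ℂ) (Amp n H) (Amp n H) :=
    Submodule.sum_mem _ fun i _ => ((hx i).comp_clm _).clm_comp (ampSingle i)
  exact this

theorem ampSingle_mem_domain {j : Fin n} {ξ : H} (hξ : ξ ∈ D.domain) :
    ampSingle j ξ ∈ (matOp M D).domain := fun i => by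
  rw [ampSingle_apply]
  split_ifs
  exacts [hξ, D.domain.zero_mem]

theorem matOp_ampSingle {j : Fin n} (ξ : D.domain) (i : Fin n) :
    matOp M D ⟨ampSingle j ξ, ampSingle_mem_domain ξ.2⟩ i = M i j (D ξ) := by
  rw [matOp_apply, Finset.sum_eq_single j]
  · congr 2
    apply Subtype.ext
    exact (ampSingle_apply j (ξ : H) j).trans (if_pos rfl)
  · intro b _ hb
    have : (⟨ampSingle j (ξ : H) b, ampSingle_mem_domain (M := M) ξ.2 b⟩ : D.domain) = 0 :=
      Subtype.ext ((ampSingle_apply j (ξ : H) b).trans (if_neg hb))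
    refine Eq.trans (congrArg (fun z => M i b (D z)) this) ?_
    simp
  · simp

theorem dense_matOp_domain (hd : Dense (D.domain : Set H)) :
    Dense ((matOp M D).domain : Set (Amp n H)) := by
  rw [Submodule.dense_iff_topologicalClosure_eq_top, eq_top_iff]
  rintro v -
  rw [← sum_ampSingle v]
  exact Submodule.sum_mem _ fun j _ => map_mem_closure (ampSingle j).continuous (hd (v j))
    fun ξ hξ => ampSingle_mem_domain hξ

theorem hasCommutator_matOp {x : Fin n → (H →L[ℂ] H)} {T : Matrix (Fin n) (Fin n) (H →L[ℂ] H)}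
    (hx : ∀ j, ∀ ξ ∈ D.domain, x j ξ ∈ D.domain)
    (hT : ∀ i j, ∀ ξ : D.domain, M i j (D ⟨x j ξ, hx j ξ ξ.2⟩) - x i (M i j (D ξ)) = T i j ξ) :
    HasCommutator (matOp M D) (diagOp x) (matBdd T) := by
  intro v
  refine ⟨fun j => hx j _ (v.2 j), ?_⟩
  ext i
  rw [PiLp.sub_apply, matOp_apply, diagOp_apply, matOp_apply, matBdd_apply, map_sum,
    ← Finset.sum_sub_distrib]
  exact Finset.sum_congr rfl fun j _ => hT i j ⟨v.1 j, v.2 j⟩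

theorem HasCommutator.diag_mem_domain {x : Fin n → (H →L[ℂ] H)} {T : Amp n H →L[ℂ] Amp n H}
    (h : HasCommutator (matOp M D) (diagOp x) T) (j : Fin n) (ξ : D.domain) :
    x j ξ ∈ D.domain := by
  have := h.mem_domain ⟨ampSingle j ξ, ampSingle_mem_domain ξ.2⟩ j
  rwa [diagOp_ampSingle, ampSingle_apply, if_pos rfl] at this

/-- Testing on vectors of one summand recovers the matrix entries, so a bound on the whole
commutator passes to each of them. -/
theorem HasCommutator.entry {x : Fin n → (H →L[ℂ] H)} {T : Amp n H →L[ℂ] Amp n H}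
    (h : HasCommutator (matOp M D) (diagOp x) T) (i j : Fin n) (ξ : D.domain) :
    M i j (D ⟨x j ξ, h.diag_mem_domain j ξ⟩) - x i (M i j (D ξ)) =
      (PiLp.proj 2 (fun _ : Fin n => H) i ∘L T ∘L ampSingle j) ξ := by
  obtain ⟨h1, h2⟩ := h ⟨ampSingle j ξ, ampSingle_mem_domain ξ.2⟩
  change _ = T (ampSingle j (ξ : H)) i
  rw [← h2, PiLp.sub_apply, diagOp_apply, matOp_ampSingle]
  congr 1
  rw [← matOp_ampSingle (M := M) ⟨x j ξ, h.diag_mem_domain j ξ⟩ i]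
  exact congrArg (fun z => matOp M D z i) (Subtype.ext (diagOp_ampSingle _ _ _).symm)

theorem HasCommutator.norm_entry_le {x : Fin n → (H →L[ℂ] H)} {T : Amp n H →L[ℂ] Amp n H}
    (h : HasCommutator (matOp M D) (diagOp x) T) (i j : Fin n) (ξ : D.domain) :
    ‖M i j (D ⟨x j ξ, h.diag_mem_domain j ξ⟩) - x i (M i j (D ξ))‖ ≤ ‖T‖ * ‖(ξ : H)‖ := by
  rw [h.entry]
  refine (PiLp.norm_apply_le (T (ampSingle j (ξ : H))) i).trans ?_
  rw [← norm_ampSingle_apply j (ξ : H)]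
  exact T.le_opNorm _

theorem map_sum_apply (hc : ∀ i j, HasCommutator D (M i j) 0) (w : Fin n → D.domain) (i : Fin n) :
    ∃ h : ∑ j, M i j (w j) ∈ D.domain,
      D ⟨∑ j, M i j (w j), h⟩ = ∑ j, M i j (D (w j)) := by
  refine ⟨Submodule.sum_mem _ fun j _ => (hc i j).mem_domain (w j), ?_⟩
  have h1 : ∀ j, D ⟨M i j (w j), (hc i j).mem_domain (w j)⟩ = M i j (D (w j)) := fun j => by
    rw [(hc i j).apply]; simp
  simp only [← h1]
  refine Eq.trans ?_ (map_sum D.toFun (fun j => ⟨M i j (w j), (hc i j).mem_domain (w j)⟩)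
    Finset.univ)
  refine congrArg D (Subtype.ext ?_)
  simp

theorem sum_mul_apply (hM : M * M = 1) (w : Fin n → H) (i : Fin n) :
    ∑ j, M i j (∑ k, M j k (w k)) = w i := by
  simp only [map_sum]
  rw [Finset.sum_comm]
  have : ∀ k, ∑ j, M i j (M j k (w k)) = ((M * M) i k) (w k) := fun k => by
    simp [Matrix.mul_apply]
  simp only [this, hM, Matrix.one_apply]
  rw [Finset.sum_eq_single i]
  · simp
  · intro b _ hb
    simp [Ne.symm hb]
  · simp

/-- Since `M² = 1` and the entries of `M` commute with `D`, the square of `M D` is `D² ⊗ 1`. -/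
theorem isInvOneAddSq_matOp (hM : M * M = 1) (hc : ∀ i j, HasCommutator D (M i j) 0)
    {R : H →L[ℂ] H} (hR : IsInvOneAddSq D R) :
    IsInvOneAddSq (matOp M D) (diagOp fun _ => R) where
  right_inv v := by
    have h1 : diagOp (fun _ => R) v ∈ (matOp M D).domain := fun i => hR.mem_domain (v i)
    have h2 : ∀ i, matOp M D ⟨_, h1⟩ i = ∑ j, M i j (D ⟨R (v j), hR.mem_domain (v j)⟩) :=
      fun i => rfl
    have h3 := map_sum_apply hc (fun j => ⟨D ⟨R (v j), hR.mem_domain (v j)⟩, hR.map_mem_domain _⟩)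
    have h4 : matOp M D ⟨_, h1⟩ ∈ (matOp M D).domain := fun i => (h3 i).1
    refine ⟨h1, h4, ?_⟩
    ext i
    rw [PiLp.add_apply, diagOp_apply, matOp_apply]
    have h5 : ∀ j, D ⟨matOp M D ⟨_, h1⟩ j, h4 j⟩ = ∑ k, M j k (v k - R (v k)) := fun j => by
      refine (h3 j).2.trans ?_
      simp only [hR.sq_apply]
    have h6 := sum_mul_apply hM (fun k => v k - R (v k)) i
    refine Eq.trans (congrArg (R (v i) + ·) ((Finset.sum_congr rfl fun j _ =>
      congrArg (M i j) (h5 j)).trans h6)) ?_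
    abel
  left_inv v h := by
    ext i
    rw [diagOp_apply, PiLp.add_apply, matOp_apply]
    -- Recovering `D v` as `M (M D v)` shows that each component of `v` lies in the domain of `D²`.
    have h1 : D ⟨(v : Amp n H) i, v.2 i⟩ = ∑ j, M i j (matOp M D v j) :=
      (sum_mul_apply hM (fun k => D ⟨(v : Amp n H) k, v.2 k⟩) i).symm
    obtain ⟨h2, h3⟩ := map_sum_apply hc (fun j => ⟨matOp M D v j, h j⟩) i
    have h4 : D ⟨(v : Amp n H) i, v.2 i⟩ ∈ D.domain := by rw [h1]; exact h2
    have h5 : D ⟨D ⟨(v : Amp n H) i, v.2 i⟩, h4⟩ = ∑ j, M i j (D ⟨matOp M D v j, h j⟩) := by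
      rw [← h3]
      congr 2
    have h6 := hR.left_inv ⟨(v : Amp n H) i, v.2 i⟩ h4
    rw [h5] at h6
    exact h6

theorem inner_matOp_symm (hD : IsSelfAdjoint D) (hM : ∀ i j, star (M i j) = M j i)
    (hc : ∀ i j, HasCommutator D (M i j) 0) (v w : (matOp M D).domain) :
    ⟪matOp M D v, (w : Amp n H)⟫_ℂ = ⟪(v : Amp n H), matOp M D w⟫_ℂ := by
  simp only [PiLp.inner_apply, matOp_apply, sum_inner, inner_sum]
  rw [Finset.sum_comm]
  refine Finset.sum_congr rfl fun j _ => Finset.sum_congr rfl fun i _ => ?_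
  have h1 := (hc j i).apply ⟨(w : Amp n H) i, w.2 i⟩
  have h2 := inner_map_symm hD ⟨(v : Amp n H) j, v.2 j⟩
    ⟨M j i ((w : Amp n H) i), (hc j i).mem_domain ⟨_, w.2 i⟩⟩
  rw [h1, zero_apply, add_zero] at h2
  refine Eq.trans ?_ h2
  rw [← ContinuousLinearMap.adjoint_inner_right, ← ContinuousLinearMap.star_eq_adjoint, hM]

theorem isSelfAdjoint_matOp (hD : IsSelfAdjoint D) (hM : ∀ i j, star (M i j) = M j i)
    (hMM : M * M = 1) (hc : ∀ i j, HasCommutator D (M i j) 0)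
    {R : H →L[ℂ] H} (hR : IsInvOneAddSq D R) : IsSelfAdjoint (matOp M D) :=
  isSelfAdjoint_of_isInvOneAddSq (dense_matOp_domain hD.dense_domain)
    (inner_matOp_symm hD hM hc) (isInvOneAddSq_matOp hMM hc hR)

end Amplification

/-! ### Singular values under amplification and the spectral dimension. -/

section SingularValues

variable {H : Type*} [NormedAddCommGroup H] [InnerProductSpace ℂ H] [CompleteSpace H]

theorem singularValue_le (T : H →L[ℂ] H) {n : ℕ} {F : H →L[ℂ] H}
    (hF : LinearMap.rank (F : H →ₗ[ℂ] H) ≤ (n : Cardinal)) : singularValue T n ≤ ‖T - F‖ :=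
  csInf_le ⟨0, by rintro _ ⟨F, -, rfl⟩; exact norm_nonneg _⟩ ⟨F, hF, rfl⟩

theorem le_singularValue (T : H →L[ℂ] H) {n : ℕ} {r : ℝ}
    (h : ∀ F : H →L[ℂ] H, LinearMap.rank (F : H →ₗ[ℂ] H) ≤ (n : Cardinal) → r ≤ ‖T - F‖) :
    r ≤ singularValue T n :=
  le_csInf ⟨_, 0, by simp, rfl⟩ (by rintro _ ⟨F, hF, rfl⟩; exact h F hF)

theorem singularValue_nonneg (T : H →L[ℂ] H) (n : ℕ) : 0 ≤ singularValue T n :=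
  le_singularValue T fun _ _ => norm_nonneg _

theorem singularValue_anti (T : H →L[ℂ] H) {m n : ℕ} (h : m ≤ n) :
    singularValue T n ≤ singularValue T m :=
  le_singularValue T fun _ hF => singularValue_le T (hF.trans (by exact_mod_cast h))

theorem norm_diagOp_le {n : ℕ} {x : Fin n → (H →L[ℂ] H)} {c : ℝ} (hc : 0 ≤ c)
    (hx : ∀ i, ‖x i‖ ≤ c) : ‖diagOp x‖ ≤ c := by
  refine ContinuousLinearMap.opNorm_le_bound _ hc fun v => ?_
  refine le_of_sq_le_sq ?_ (by positivity)
  rw [mul_pow, PiLp.norm_sq_eq_of_L2, PiLp.norm_sq_eq_of_L2, Finset.mul_sum]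
  refine Finset.sum_le_sum fun i _ => ?_
  rw [← mul_pow, diagOp_apply]
  gcongr
  exact (x i).le_of_opNorm_le (hx i) _

/-- Compressing an approximant to the `j`-th corner raises neither its rank nor the error. -/
theorem singularValue_le_singularValue_diagOp {m : ℕ} (j : Fin m) (T : H →L[ℂ] H) (n : ℕ) :
    singularValue T n ≤ singularValue (diagOp fun _ : Fin m => T) n := by
  refine le_singularValue _ fun F hF => ?_
  let G : H →L[ℂ] H := PiLp.proj 2 (fun _ : Fin m => H) j ∘L F ∘L ampSingle j
  have hG : LinearMap.rank (G : H →ₗ[ℂ] H) ≤ (n : Cardinal) := by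
    refine le_trans ?_ hF
    exact (LinearMap.rank_comp_le_right _ _).trans (LinearMap.rank_comp_le_left _ _)
  refine (singularValue_le T hG).trans (ContinuousLinearMap.opNorm_le_bound _ (norm_nonneg _)
    fun ξ => ?_)
  have h1 : (T - G) ξ = ((diagOp fun _ : Fin m => T) - F) (ampSingle j ξ) j := by
    change T ξ - F (ampSingle j ξ) j = (diagOp (fun _ : Fin m => T) (ampSingle j ξ)) j - _
    rw [diagOp_ampSingle, ampSingle_apply, if_pos rfl]
    rfl
  rw [h1, ← norm_ampSingle_apply j ξ]
  exact (PiLp.norm_apply_le _ j).trans (ContinuousLinearMap.le_opNorm _ _)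

/-- `m` copies of an approximant of rank at most `n` have rank at most `m * n` and the same error.
-/
theorem singularValue_diagOp_le {m : ℕ} (T : H →L[ℂ] H) (n : ℕ) :
    singularValue (diagOp fun _ : Fin m => T) (m * n) ≤ singularValue T n := by
  refine le_singularValue _ fun F hF => ?_
  have hrank : LinearMap.rank ((diagOp fun _ : Fin m => F : Amp m H →L[ℂ] Amp m H) :
      Amp m H →ₗ[ℂ] Amp m H) ≤ ((m * n : ℕ) : Cardinal) := by
    have h : ((diagOp fun _ : Fin m => F : Amp m H →L[ℂ] Amp m H) : Amp m H →ₗ[ℂ] Amp m H) =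
        ∑ i, ((ampSingle i : H →L[ℂ] Amp m H) : H →ₗ[ℂ] Amp m H) ∘ₗ (F : H →ₗ[ℂ] H) ∘ₗ
          ((PiLp.proj 2 (fun _ : Fin m => H) i : Amp m H →L[ℂ] H) : Amp m H →ₗ[ℂ] H) := by
      ext v i
      simp [ampSingle_apply]
    rw [h]
    refine (LinearMap.rank_finsetSum_le _ _).trans ?_
    refine (Finset.sum_le_card_nsmul _ _ (n : Cardinal) fun i _ => ?_).trans ?_
    · exact ((LinearMap.rank_comp_le_right _ _).trans (LinearMap.rank_comp_le_left _ _)).trans hF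
    · simp
  refine (singularValue_le _ hrank).trans ?_
  have h2 : (diagOp fun _ : Fin m => T) - (diagOp fun _ : Fin m => F) =
      diagOp fun _ : Fin m => T - F := by
    ext v i; rfl
  rw [h2]
  exact norm_diagOp_le (norm_nonneg _) fun _ => le_rfl

theorem sum_range_mul_div (f : ℕ → ℝ) {m : ℕ} (hm : 0 < m) (N : ℕ) :
    ∑ j ∈ Finset.range (m * N), f (j / m) = m * ∑ n ∈ Finset.range N, f n := by
  induction N with
  | zero => simp
  | succ N ih =>
    rw [mul_add, mul_one, Finset.sum_range_add, ih, Finset.sum_range_succ, mul_add]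
    congr 1
    rw [Finset.sum_congr rfl (g := fun _ => f N)]
    · simp
    · intro x hx
      rw [Nat.mul_add_div hm, Nat.div_eq_of_lt (Finset.mem_range.1 hx), add_zero]

theorem inDixmierClass_diagOp_iff {m : ℕ} (hm : 0 < m) (T : H →L[ℂ] H) :
    InDixmierClass (diagOp fun _ : Fin m => T) ↔ InDixmierClass T := by
  constructor
  · rintro ⟨C, hC⟩
    exact ⟨C, fun N => (Finset.sum_le_sum fun n _ =>
      singularValue_le_singularValue_diagOp ⟨0, hm⟩ T n).trans (hC N)⟩
  · rintro ⟨C, hC⟩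
    refine ⟨m * C, fun N => ?_⟩
    -- The sum is padded to `m * N` terms so that it splits into `N` blocks of length `m`, each
    -- bounded by `m` times one singular value of `T`.
    calc ∑ n ∈ Finset.range N, singularValue (diagOp fun _ : Fin m => T) n
        ≤ ∑ n ∈ Finset.range (m * N), singularValue (diagOp fun _ : Fin m => T) n :=
          Finset.sum_le_sum_of_subset_of_nonneg
            (Finset.range_mono (Nat.le_mul_of_pos_left N hm)) fun _ _ _ => singularValue_nonneg _ _
      _ ≤ ∑ n ∈ Finset.range (m * N), singularValue T (n / m) :=
          Finset.sum_le_sum fun n _ => (singularValue_anti _ (Nat.mul_div_le n m)).trans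
            (singularValue_diagOp_le T (n / m))
      _ = m * ∑ n ∈ Finset.range N, singularValue T n := sum_range_mul_div _ hm N
      _ ≤ m * (C * Real.log (1 + N)) := by gcongr; exact hC N
      _ = m * C * Real.log (1 + N) := by ring

/-- The diagonal embedding `x ↦ x ⊗ 1`. -/
def ampHom (n : ℕ) : (H →L[ℂ] H) →⋆ₐ[ℂ] (Amp n H →L[ℂ] Amp n H) :=
  { diagRep (E := H →L[ℂ] H) fun _ : Fin n => NonUnitalStarAlgHom.id ℂ (H →L[ℂ] H) with
    map_one' := by ext v i; rfl
    commutes' := fun c => by ext v i; rfl }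

theorem cfc_diagOp {n : ℕ} {f : ℝ → ℝ} (hf : Continuous f) {R : H →L[ℂ] H}
    (hR : IsSelfAdjoint R) : cfc f (diagOp fun _ : Fin n => R) = diagOp fun _ => cfc f R := by
  have hcont : Continuous (ampHom (H := H) n) :=
    AddMonoidHomClass.continuous_of_bound (ampHom (H := H) n) 1 fun x => by
      rw [one_mul]; exact norm_diagOp_le (norm_nonneg _) fun _ => le_rfl
  exact ((ampHom n).map_cfc f R hf.continuousOn hcont hR (hR.map (ampHom n))).symm

theorem spectralDim_matOp {n : ℕ} (hn : 0 < n) {D : H →ₗ.[ℂ] H}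
    {M : Matrix (Fin n) (Fin n) (H →L[ℂ] H)} (hD : IsSelfAdjoint D) (hM : M * M = 1)
    (hc : ∀ i j, HasCommutator D (M i j) 0) {R : H →L[ℂ] H} (hR : IsInvOneAddSq D R) :
    spectralDim (matOp M D) = spectralDim D := by
  have key : ∀ p : ℝ, 0 < p → (IsSummable (matOp M D) p ↔ IsSummable D p) := by
    intro p hp
    have hf : Continuous fun t : ℝ => t ^ (p / 2) := Real.continuous_rpow_const (by positivity)
    have hRR := isInvOneAddSq_matOp hM hc hR
    constructor
    · rintro ⟨R', hR', h⟩
      rw [hR'.unique hRR, cfc_diagOp hf (hR.isSelfAdjoint hD), inDixmierClass_diagOp_iff hn] at h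
      exact ⟨R, hR, h⟩
    · rintro ⟨R', hR', h⟩
      rw [hR'.unique hR] at h
      refine ⟨_, hRR, ?_⟩
      rwa [cfc_diagOp hf (hR.isSelfAdjoint hD), inDixmierClass_diagOp_iff hn]
  unfold spectralDim
  refine iInf_congr fun p => iInf_congr fun hp => ?_
  rw [key p hp]

end SingularValues

/-! ### Commutators with the Dirac operator of the extension. -/

section Commutators

variable {H : Type*} [NormedAddCommGroup H] [InnerProductSpace ℂ H] [CompleteSpace H]
  {D : H →ₗ.[ℂ] H}

/-- The operator `z D`, defined on `dom D`, is the restriction of the bounded operator `S`. -/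
def HasRightBound (D : H →ₗ.[ℂ] H) (z S : H →L[ℂ] H) : Prop := ∀ ξ : D.domain, z (D ξ) = S ξ

theorem HasRightBound.neg {z S : H →L[ℂ] H} (h : HasRightBound D z S) :
    HasRightBound D (-z) (-S) := fun ξ => by simp [h ξ]

theorem HasRightBound.mul {z S w : H →L[ℂ] H} (h : HasRightBound D z S)
    (hw : HasCommutator D w 0) : HasRightBound D (z * w) (S * w) := fun ξ => by
  have h1 := hw.apply ξ
  rw [zero_apply, add_zero] at h1
  have h2 := h ⟨w ξ, hw.mem_domain ξ⟩
  rw [h1] at h2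
  exact h2

theorem IsDiffCompact.exists_hasRightBound {y : H →L[ℂ] H} (h : IsDiffCompact D y) :
    ∃ S, HasRightBound D y S := h.bounded_right

theorem IsDiffCompact.exists_hasCommutator {y : H →L[ℂ] H} (h : IsDiffCompact D y) :
    ∃ T, HasCommutator D y T := by
  obtain ⟨S, hS⟩ := h.bounded_right
  obtain ⟨T, hT⟩ := h.bounded_left
  exact ⟨T - S, fun ξ => ⟨h.map_domain ξ ξ.2, by rw [hT, hS]; rfl⟩⟩

/-- Entrywise, `[M D, x] = (M x - x M) D + M [D, x]`. -/
theorem hasCommutator_matOp_of_hasRightBound {n : ℕ} {M : Matrix (Fin n) (Fin n) (H →L[ℂ] H)}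
    {x : Fin n → (H →L[ℂ] H)} {T : Fin n → (H →L[ℂ] H)}
    {S : Matrix (Fin n) (Fin n) (H →L[ℂ] H)} (hx : ∀ j, HasCommutator D (x j) (T j))
    (hS : ∀ i j, HasRightBound D (M i j * x j - x i * M i j) (S i j)) :
    HasCommutator (matOp M D) (diagOp x) (matBdd fun i j => S i j + M i j * T j) := by
  refine hasCommutator_matOp (fun j ξ hξ => (hx j).mem_domain ⟨ξ, hξ⟩) fun i j ξ => ?_
  have h1 := hS i j ξ
  rw [(hx j).apply, map_add]
  change _ = S i j ξ + M i j (T j ξ)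
  rw [← h1]
  change _ = M i j (x j (D ξ)) - x i (M i j (D ξ)) + _
  abel

/-- The matrix of the Dirac operator of the extension. -/
def extMat (s : ℤˣ) (P : H →L[ℂ] H) : Matrix (Fin 6) (Fin 6) (H →L[ℂ] H) :=
  let Q : H →L[ℂ] H := 1 - P
  !![1,  0, 0, 0,     0, 0;
     0, -1, 0, 0,     0, 0;
     0,  0, 0, 0,     Q, P;
     0,  0, 0, 0,     P, (s : ℤ) • Q;
     0,  0, Q, P,     0, 0;
     0,  0, P, (s : ℤ) • Q, 0, 0]

theorem extDirac_eq (s : ℤˣ) (D : H →ₗ.[ℂ] H) (P : H →L[ℂ] H) :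
    extDirac s D P = matOp (extMat s P) D := rfl

/-- The entries of `extMat` are `0`, `1`, `P` and `1 - P`, up to sign. -/
theorem extMat_induction {p : (H →L[ℂ] H) → Prop} (s : ℤˣ) (P : H →L[ℂ] H) (h0 : p 0) (h1 : p 1)
    (hP : p P) (hQ : p (1 - P)) (hneg : ∀ x, p x → p (-x)) (i j : Fin 6) : p (extMat s P i j) := by
  have hs : p ((s : ℤ) • (1 - P)) := by
    rcases Int.units_eq_one_or s with rfl | rfl
    · simpa using hQ
    · have := hneg _ hQ
      simpa using this
  fin_cases i <;> fin_cases j <;> first | exact h0 | exact h1 | exact hP | exact hQ | exact hs |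
    exact hneg _ h1

theorem extMat_symm (s : ℤˣ) (P : H →L[ℂ] H) (i j : Fin 6) : extMat s P i j = extMat s P j i := by
  fin_cases i <;> fin_cases j <;> rfl

theorem star_extMat (s : ℤˣ) {P : H →L[ℂ] H} (hP : IsStarProjection P) (i j : Fin 6) :
    star (extMat s P i j) = extMat s P j i := by
  rw [extMat_symm s P j i]
  refine extMat_induction (p := fun x => star x = x) s P (star_zero _) (star_one _)
    hP.isSelfAdjoint ?_ (fun x hx => by rw [star_neg, hx]) i j
  rw [star_sub, star_one, hP.isSelfAdjoint.star_eq]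

theorem hasCommutator_one_sub {P : H →L[ℂ] H} (hP : HasCommutator D P 0) :
    HasCommutator D (1 - P) 0 := by
  have := HasCommutator.one.add (hP.smul (-1))
  simpa [sub_eq_add_neg] using this

theorem hasCommutator_extMat (s : ℤˣ) {P : H →L[ℂ] H} (hP : HasCommutator D P 0) (i j : Fin 6) :
    HasCommutator D (extMat s P i j) 0 := by
  refine extMat_induction (p := fun x => HasCommutator D x 0) s P .zero .one hP
    (hasCommutator_one_sub hP) (fun x hx => ?_) i j
  have := hx.smul (-1)
  simpa using this

/-- For `Q = 1 - P` the block `[[Q, P], [P, s Q]]` has square `(P + Q) ⊗ 1 = 1`, as `P Q = Q P = 0`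
and `s² = 1`. -/
theorem extMat_mul_self (s : ℤˣ) {P : H →L[ℂ] H} (hP : IsStarProjection P) :
    extMat s P * extMat s P = 1 := by
  have hPP : P * P = P := hP.isIdempotentElem
  rcases Int.units_eq_one_or s with rfl | rfl <;>
  · ext1 i j
    fin_cases i <;> fin_cases j <;>
      simp [extMat, Matrix.mul_apply, Fin.sum_univ_succ, mul_sub, sub_mul, hPP]

/-- In the off-diagonal block `P` always links an `a` with a `y`, giving `P a - y` or `y - a P`. The
entry `Q = 1 - P` links `y` with `y`, where it commutes, and `s Q` links `a` with `a`, giving `∓ [P,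
a]`. -/
theorem extMat_commutator_induction {p : (H →L[ℂ] H) → Prop} (s : ℤˣ) {P a y : H →L[ℂ] H}
    (hP : IsStarProjection P) (hPy : P * y * P = y) (h0 : p 0) (h₁ : p (P * a - y))
    (h₂ : p (y - a * P)) (h₃ : p (P * a - a * P)) (hneg : ∀ x, p x → p (-x)) (i j : Fin 6) :
    p (extMat s P i j * (![a, a, y, a, y, a] : Fin 6 → (H →L[ℂ] H)) j -
      (![a, a, y, a, y, a] : Fin 6 → (H →L[ℂ] H)) i * extMat s P i j) := by
  have hPP : P * P = P := hP.isIdempotentElem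
  have hyP : y * P = y := by rw [← hPy, mul_assoc, hPP]
  have hPy' : P * y = y := by rw [← hPy, ← mul_assoc, ← mul_assoc, hPP]
  have hQy : (1 - P) * y - y * (1 - P) = 0 := by
    rw [sub_mul, mul_sub, one_mul, mul_one, hyP, hPy']
    simp
  have hQa : p (((s : ℤ) • (1 - P)) * a - a * ((s : ℤ) • (1 - P))) := by
    have : ((s : ℤ) • (1 - P)) * a - a * ((s : ℤ) • (1 - P)) = -((s : ℤ) • (P * a - a * P)) := by
      rw [smul_mul_assoc, mul_smul_comm, ← smul_sub, ← smul_neg]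
      congr 1
      noncomm_ring
    rw [this]
    rcases Int.units_eq_one_or s with rfl | rfl
    · simpa using hneg _ h₃
    · simpa using h₃
  -- `1 - P` and its signed copy become variables, so that the simplifier does not expand them.
  have key : ∀ Q Q' : H →L[ℂ] H, p (Q * y - y * Q) → p (Q' * a - a * Q') → ∀ i j : Fin 6,
      p ((!![1, 0, 0, 0, 0, 0; 0, -1, 0, 0, 0, 0; 0, 0, 0, 0, Q, P; 0, 0, 0, 0, P, Q';
          0, 0, Q, P, 0, 0; 0, 0, P, Q', 0, 0] : Matrix (Fin 6) (Fin 6) (H →L[ℂ] H)) i j *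
        (![a, a, y, a, y, a] : Fin 6 → (H →L[ℂ] H)) j -
        (![a, a, y, a, y, a] : Fin 6 → (H →L[ℂ] H)) i *
        (!![1, 0, 0, 0, 0, 0; 0, -1, 0, 0, 0, 0; 0, 0, 0, 0, Q, P; 0, 0, 0, 0, P, Q';
          0, 0, Q, P, 0, 0; 0, 0, P, Q', 0, 0] : Matrix (Fin 6) (Fin 6) (H →L[ℂ] H)) i j) := by
    intro Q Q' hQ hQ' i j
    fin_cases i <;> fin_cases j <;> simp [hyP, hPy'] <;> assumption
  exact key _ _ (by rw [hQy]; exact h0) hQa i j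

/-- A criterion for the boundedness of `[D, a ⊕ a ⊕ y ⊕ a ⊕ y ⊕ a]`. -/
theorem exists_hasCommutator_extDirac (s : ℤˣ) {P a y T S : H →L[ℂ] H}
    (hP : IsStarProjection P) (ha : HasCommutator D a T) (hy : HasCommutator D y S)
    (hPy : P * y * P = y) (h₁ : ∃ S, HasRightBound D (P * a - y) S)
    (h₂ : ∃ S, HasRightBound D (y - a * P) S) (h₃ : ∃ S, HasRightBound D (P * a - a * P) S) :
    ∃ T, HasCommutator (extDirac s D P) (diagOp ![a, a, y, a, y, a]) T := by
  have hx : ∀ j, ∃ T, HasCommutator D ((![a, a, y, a, y, a] : Fin 6 → (H →L[ℂ] H)) j) T := by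
    intro j
    fin_cases j
    exacts [⟨T, ha⟩, ⟨T, ha⟩, ⟨S, hy⟩, ⟨T, ha⟩, ⟨S, hy⟩, ⟨T, ha⟩]
  choose T' hT' using hx
  choose S' hS' using extMat_commutator_induction (p := fun z => ∃ S, HasRightBound D z S) s hP hPy
    ⟨0, fun ξ => rfl⟩ h₁ h₂ h₃ fun x ⟨S, hS⟩ => ⟨-S, hS.neg⟩
  exact ⟨_, hasCommutator_matOp_of_hasRightBound hT' hS'⟩

/-- The operator `1 ⊕ 1 ⊕ P ⊕ 1 ⊕ P ⊕ 1` commutes with the Dirac operator of the extension. -/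
theorem hasCommutator_extDirac_one (s : ℤˣ) {P : H →L[ℂ] H} (hP : IsStarProjection P)
    (hc : HasCommutator D P 0) :
    HasCommutator (extDirac s D P) (diagOp ![1, 1, P, 1, P, 1]) 0 := by
  have hPP : P * P = P := hP.isIdempotentElem
  have hx : ∀ j, HasCommutator D ((![1, 1, P, 1, P, 1] : Fin 6 → (H →L[ℂ] H)) j) 0 := by
    intro j
    fin_cases j
    exacts [.one, .one, hc, .one, hc, .one]
  have hz := extMat_commutator_induction (p := fun z => z = 0) s hP (a := 1) (y := P)
    (by rw [hPP, hPP]) rfl (by simp) (by simp) (by simp) fun x hx => by simp [hx]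
  have := hasCommutator_matOp_of_hasRightBound (M := extMat s P) (S := 0) hx fun i j ξ => by
    rw [hz]; rfl
  rwa [show (matBdd fun i j => (0 : Matrix (Fin 6) (Fin 6) (H →L[ℂ] H)) i j +
      extMat s P i j * 0) = 0 from ContinuousLinearMap.ext fun v => PiLp.ext fun i =>
        (matBdd_apply _ v i).trans (by simp)] at this

end Commutators

/-! ### The extension and its spectral triple. -/

section Extension

variable {A E H : Type*} [CStarAlgebra A] [CStarAlgebra E]
  [NormedAddCommGroup H] [InnerProductSpace ℂ H] [CompleteSpace H]
  {𝒜 : NonUnitalStarSubalgebra ℂ A} {πA : A →⋆ₐ[ℂ] (H →L[ℂ] H)} {D : H →ₗ.[ℂ] H}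
  {P : H →L[ℂ] H} {σ : E →⋆ₐ[ℂ] A} {π : E →⋆ₙₐ[ℂ] (H →L[ℂ] H)}

theorem extRep_apply (e : E) :
    extRep πA σ π e = diagOp ![πA (σ e), πA (σ e), π e, πA (σ e), π e, πA (σ e)] := by
  have : (fun i : Fin 6 => (![(πA.comp σ).toNonUnitalStarAlgHom, (πA.comp σ).toNonUnitalStarAlgHom,
      π, (πA.comp σ).toNonUnitalStarAlgHom, π, (πA.comp σ).toNonUnitalStarAlgHom] :
      Fin 6 → (E →⋆ₙₐ[ℂ] (H →L[ℂ] H))) i e) =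
      ![πA (σ e), πA (σ e), π e, πA (σ e), π e, πA (σ e)] := by
    funext i
    fin_cases i <;> rfl
  exact congrArg diagOp this

namespace IsToeplitzExtension

theorem exists_lift (hE : IsToeplitzExtension πA P σ π) (a : A) :
    ∃ e, π e = P * πA a * P := by
  obtain ⟨e, rfl⟩ := hE.surjective a
  obtain ⟨k, hk, he⟩ := hE.decomposition e
  obtain ⟨f, hf⟩ := hE.compacts_le_range k hk
  exact ⟨e - f, by rw [map_sub, he, hf, add_sub_cancel_right]⟩

/-- The difference `P (a - σ e) P` is compact, so it vanishes by disjointness; a lift of `a - σ e`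
is then mapped by `π` into the compacts, and exactness gives `a = σ e`. -/
theorem sigma_eq (hE : IsToeplitzExtension πA P σ π) {e : E} {a : A} (h : π e = P * πA a * P) :
    σ e = a := by
  obtain ⟨k, hk, he⟩ := hE.decomposition e
  have h1 : P * πA (a - σ e) * P = k := by
    rw [map_sub, mul_sub, sub_mul, ← h, he, add_sub_cancel_left]
  have h2 : P * πA (a - σ e) * P = 0 := hE.disjoint _ (by rw [h1]; exact hk.1)
  obtain ⟨f, hf⟩ := hE.surjective (a - σ e)
  obtain ⟨l, hl, hfl⟩ := hE.decomposition f
  rw [hf, h2, zero_add] at hfl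
  have h3 : σ f = 0 := (hE.exact f).2 (by rw [hfl]; exact hl)
  rw [hf] at h3
  exact (sub_eq_zero.1 h3).symm

/-- If `π 1 = P + k`, then `k = π 1 * k = k + k * k`, so the self-adjoint operator `k` has square
zero. -/
theorem pi_one (hE : IsToeplitzExtension πA P σ π) : π 1 = P := by
  have hPP : P * P = P := hE.projection.isIdempotentElem
  obtain ⟨k, hk, he⟩ := hE.decomposition 1
  rw [map_one σ, map_one πA, mul_one, hPP] at he
  obtain ⟨f, hf⟩ := hE.compacts_le_range k hk
  have hk1 : star k = k := by
    have : k = π 1 - P := by rw [he, add_sub_cancel_left]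
    rw [this, star_sub, ← map_star, star_one, hE.projection.isSelfAdjoint.star_eq]
  have hPk : P * k = k := by rw [← hk.2, ← mul_assoc, ← mul_assoc, hPP]
  have hkk : k * k = 0 := by
    have : π 1 * k = k := by rw [← hf, ← map_mul, one_mul]
    rw [he, add_mul, hPk] at this
    exact add_eq_left.1 this
  have hk0 : k = 0 := by
    rw [← CStarRing.star_mul_self_eq_zero_iff, hk1, hkk]
  rw [he, hk0, add_zero]

end IsToeplitzExtension

/-- Bounded commutators are stable under sums, products and adjoints, so only the two kinds of
generators need work. -/
theorem smoothAlg_le (hE : IsToeplitzExtension πA P σ π) (hP : IsToeplitzQuadruple 𝒜 πA D P)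
    (hA : IsSpectralTriple 𝒜 πA.toNonUnitalStarAlgHom D) (s : ℤˣ)
    (hsa : IsSelfAdjoint (extDirac s D P)) {e : E} (he : e ∈ smoothAlg 𝒜 πA D P π) :
    σ e ∈ 𝒜 ∧ ∃ T, HasCommutator (extDirac s D P) (extRep πA σ π e) T := by
  have hproj := hE.projection
  have hPP : P * P = P := hproj.isIdempotentElem
  induction he using NonUnitalStarAlgebra.adjoin_induction with
  | mem e he =>
    rcases he with ⟨hy, hPy⟩ | ⟨a, ha, hea⟩
    · have hσ : σ e = 0 := (hE.exact e).2 ⟨hy.compact, hPy⟩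
      refine ⟨by rw [hσ]; exact zero_mem _, ?_⟩
      obtain ⟨S, hS⟩ := hy.exists_hasRightBound
      obtain ⟨T, hT⟩ := hy.exists_hasCommutator
      rw [extRep_apply, hσ, map_zero]
      refine exists_hasCommutator_extDirac s hproj .zero hT hPy ⟨-S, ?_⟩ ⟨S, ?_⟩ ⟨0, ?_⟩
      · rw [mul_zero, zero_sub]; exact hS.neg
      · rw [zero_mul, sub_zero]; exact hS
      · rw [mul_zero, zero_mul, sub_self]; exact fun ξ => rfl
    · have hσ : σ e = a := hE.sigma_eq hea
      refine ⟨by rwa [hσ], ?_⟩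
      obtain ⟨T, hT⟩ := hA.bounded_commutator a ha
      obtain ⟨S, hS⟩ := (hP.regular a ha).exists_hasRightBound
      rw [extRep_apply, hσ, hea]
      refine exists_hasCommutator_extDirac s hproj hT ((hP.commute.mul hT).mul hP.commute) ?_
        ⟨S * (1 - P), ?_⟩ ⟨S * P, ?_⟩ ⟨S, hS⟩
      · change P * (P * πA a * P) * P = P * πA a * P
        simp only [← mul_assoc, hPP]
        rw [mul_assoc, hPP]
      -- Both off-diagonal differences are `[P, a]` times `1 - P` or `P`, which commute with `D`.
      · have : P * πA a - P * πA a * P = (P * πA a - πA a * P) * (1 - P) := by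
          rw [mul_sub, mul_one, sub_mul, mul_assoc (πA a), hPP]
          abel
        rw [this]
        exact hS.mul (hasCommutator_one_sub hP.commute)
      · have : P * πA a * P - πA a * P = (P * πA a - πA a * P) * P := by
          rw [sub_mul, mul_assoc (πA a), hPP]
        rw [this]
        exact hS.mul hP.commute
  | zero => exact ⟨by rw [map_zero]; exact zero_mem _, 0, by rw [map_zero]; exact .zero⟩
  | add x y _ _ hx hy =>
    obtain ⟨hx, T, hT⟩ := hx
    obtain ⟨hy, S, hS⟩ := hy
    exact ⟨by rw [map_add]; exact add_mem hx hy, _, by rw [map_add]; exact hT.add hS⟩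
  | mul x y _ _ hx hy =>
    obtain ⟨hx, T, hT⟩ := hx
    obtain ⟨hy, S, hS⟩ := hy
    exact ⟨by rw [map_mul]; exact mul_mem hx hy, _, by rw [map_mul]; exact hT.mul hS⟩
  | smul c x _ hx =>
    obtain ⟨hx, T, hT⟩ := hx
    exact ⟨by rw [map_smul]; exact SMulMemClass.smul_mem c hx, _, by rw [map_smul]; exact hT.smul c⟩
  | star x _ hx =>
    obtain ⟨hx, T, hT⟩ := hx
    exact ⟨by rw [map_star]; exact star_mem hx, _, by rw [map_star]; exact hT.star hsa⟩

theorem dense_smoothAlg (hE : IsToeplitzExtension πA P σ π) (hP : IsToeplitzQuadruple 𝒜 πA D P)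
    (hA : IsSpectralTriple 𝒜 πA.toNonUnitalStarAlgHom D) :
    Dense (smoothAlg 𝒜 πA D P π : Set E) := by
  intro e
  rw [Metric.mem_closure_iff]
  intro ε hε
  obtain ⟨k, hk, he⟩ := hE.decomposition e
  obtain ⟨a, ha, hae⟩ := Metric.mem_closure_iff.1 (hA.dense (σ e)) (ε / 2) (half_pos hε)
  obtain ⟨y, hy, hky⟩ := Metric.mem_closure_iff.1
    (mem_closure_diffCompactOn hA.selfAdjoint hE.projection hP.commute hk) (ε / 2) (half_pos hε)
  obtain ⟨e₁, he₁⟩ := hE.exists_lift a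
  obtain ⟨e₂, he₂⟩ := hE.compacts_le_range y ⟨hy.1.compact, hy.2⟩
  refine ⟨e₁ + e₂, add_mem (NonUnitalStarAlgebra.subset_adjoin ℂ _ (Or.inr ⟨a, ha, he₁⟩))
    (NonUnitalStarAlgebra.subset_adjoin ℂ _ (Or.inl
      (by rw [Set.mem_ofPred_eq, he₂]; exact hy))), ?_⟩
  rw [dist_eq_norm] at hae hky ⊢
  rw [← NonUnitalStarAlgHom.norm_map π hE.injective]
  have h1 : π (e - (e₁ + e₂)) = P * πA (σ e - a) * P + (k - y) := by
    rw [map_sub, map_add, he, he₁, he₂, map_sub, mul_sub, sub_mul]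
    abel
  have h2 : ‖P‖ ≤ 1 := hE.projection.norm_le
  have h3 : ‖πA (σ e - a)‖ ≤ ‖σ e - a‖ := NonUnitalStarAlgHom.norm_apply_le πA _
  rw [h1]
  calc _ ≤ ‖P‖ * ‖πA (σ e - a)‖ * ‖P‖ + ‖k - y‖ := (norm_add_le _ _).trans
        (by gcongr; exact (norm_mul_le _ _).trans (by gcongr; exact norm_mul_le _ _))
    _ ≤ 1 * ‖σ e - a‖ * 1 + ‖k - y‖ := by gcongr
    _ < ε := by linarith

theorem isSelfAdjoint_extDirac (hE : IsToeplitzExtension πA P σ π)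
    (hP : IsToeplitzQuadruple 𝒜 πA D P) (hA : IsSpectralTriple 𝒜 πA.toNonUnitalStarAlgHom D)
    (s : ℤˣ) : IsSelfAdjoint (extDirac s D P) := by
  obtain ⟨R, hR, -⟩ := hA.compact_resolvent
  exact isSelfAdjoint_matOp hA.selfAdjoint (star_extMat s hE.projection)
    (extMat_mul_self s hE.projection) (hasCommutator_extMat s hP.commute) hR

theorem isSpectralTriple_extDirac (hE : IsToeplitzExtension πA P σ π)
    (hP : IsToeplitzQuadruple 𝒜 πA D P) (hA : IsSpectralTriple 𝒜 πA.toNonUnitalStarAlgHom D)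
    (s : ℤˣ) :
    IsSpectralTriple (smoothAlg 𝒜 πA D P π) (extRep πA σ π) (extDirac s D P) where
  faithful e f h := by
    apply hE.injective
    ext ξ
    rw [extRep_apply, extRep_apply] at h
    -- The summand of index 2 carries the faithful representation `π`.
    have := congrArg (fun v : Amp 6 H => v 2) (DFunLike.congr_fun h (ampSingle 2 ξ))
    simp only [diagOp_ampSingle, ampSingle_apply, if_true] at this
    exact this
  dense := dense_smoothAlg hE hP hA
  dense_domain := dense_matOp_domain hA.dense_domain
  selfAdjoint := isSelfAdjoint_extDirac hE hP hA s
  bounded_commutator e he := (smoothAlg_le hE hP hA s (isSelfAdjoint_extDirac hE hP hA s) he).2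
  compact_resolvent := by
    obtain ⟨R, hR, hc⟩ := hA.compact_resolvent
    refine ⟨_, isInvOneAddSq_matOp (extMat_mul_self s hE.projection)
      (hasCommutator_extMat s hP.commute) hR, fun e => ?_⟩
    have hRc : IsCompactOperator R := by
      have := hc 1
      rwa [show πA.toNonUnitalStarAlgHom 1 = 1 from map_one πA, one_mul] at this
    exact (isCompactOperator_diagOp fun _ => hRc).clm_comp (extRep πA σ π e)

end Extension

/-! ### States, and elements modulo scalars. -/

section States

variable {A : Type*} [CStarAlgebra A]

/-- Positivity at `a + c` with `c = 1` and `c = i` makes `ω` hermitian, and with `c = -ω a` gives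
`‖ω a‖² ≤ ω (a* a)`. The bound `a* a ≤ ‖a‖²` finishes. -/
theorem IsState.norm_apply_le {ω : A →L[ℂ] ℂ} (hω : IsState ω) (a : A) : ‖ω a‖ ≤ ‖a‖ := by
  have him : ∀ b : A, (ω (star b * b)).im = 0 := fun b =>
    (Complex.nonneg_iff.1 (hω.nonneg b)).2.symm
  have hexp : ∀ c : ℂ, ω (star (a + algebraMap ℂ A c) * (a + algebraMap ℂ A c)) =
      ω (star a * a) + c * ω (star a) + star c * ω a + star c * c := by
    intro c
    have : star (a + algebraMap ℂ A c) * (a + algebraMap ℂ A c) =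
        star a * a + c • star a + star c • a + (star c * c) • (1 : A) := by
      rw [star_add, ← algebraMap_star_comm]
      simp only [Algebra.algebraMap_eq_smul_one, add_mul, mul_add, mul_smul_comm, smul_mul_assoc,
        one_mul, mul_one, smul_add, smul_smul, mul_comm c (star c)]
      abel
    rw [this]
    simp only [map_add, map_smul, hω.map_one, smul_eq_mul, mul_one]
  have h0 := him a
  have hstar : ω (star a) = star (ω a) := by
    have h1 := him (a + algebraMap ℂ A 1)
    have h2 := him (a + algebraMap ℂ A Complex.I)
    rw [hexp] at h1 h2
    simp [h0] at h1 h2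
    apply Complex.ext
    · simp; linarith
    · simp; linarith
  have hle : ‖ω a‖ ^ 2 ≤ (ω (star a * a)).re := by
    have h1 := (Complex.nonneg_iff.1 (hω.nonneg (a + algebraMap ℂ A (-ω a)))).1
    rw [hexp, hstar] at h1
    have h2 : (ω (star a * a) + -ω a * star (ω a) + star (-ω a) * ω a + star (-ω a) * -ω a).re =
        (ω (star a * a)).re - ‖ω a‖ ^ 2 := by
      rw [Complex.sq_norm, Complex.normSq_apply]
      simp
      ring
    rw [h2] at h1
    linarith
  have hle' : (ω (star a * a)).re ≤ ‖a‖ ^ 2 := by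
    let _ := CStarAlgebra.spectralOrder A
    let _ := CStarAlgebra.spectralOrderedRing A
    have h1 : 0 ≤ algebraMap ℝ A (‖a‖ ^ 2) - star a * a :=
      sub_nonneg.2 CStarAlgebra.star_mul_le_algebraMap_norm_sq
    obtain ⟨b, hb⟩ := CStarAlgebra.nonneg_iff_eq_star_mul_self.1 h1
    have h2 := hω.nonneg b
    rw [← hb, map_sub, IsScalarTower.algebraMap_apply ℝ ℂ A, Algebra.algebraMap_eq_smul_one,
      map_smul, hω.map_one] at h2
    have h3 := (Complex.nonneg_iff.1 h2).1
    simp at h3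
    rwa [← Complex.ofReal_pow, Complex.ofReal_re] at h3
  exact le_of_sq_le_sq (hle.trans hle') (norm_nonneg a)

theorem norm_sub_le_of_stateDist_le {H : Type*} [NormedAddCommGroup H] [InnerProductSpace ℂ H]
    [CompleteSpace H] {𝒜 : NonUnitalStarSubalgebra ℂ A} {π : A →⋆ₙₐ[ℂ] (H →L[ℂ] H)}
    {D : H →ₗ.[ℂ] H} {ω₁ ω₂ : A →L[ℂ] ℂ} {r : ℝ}
    (h : stateDist 𝒜 π D ω₁ ω₂ ≤ ENNReal.ofReal r) {a : A} (ha : a ∈ 𝒜)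
    (hL : commNorm D (π a) ≤ 1) : ‖ω₁ a - ω₂ a‖ ≤ max r 0 := by
  have h1 : ‖ω₁ a - ω₂ a‖ₑ ≤ ENNReal.ofReal r :=
    le_trans (le_iSup₂_of_le (f := fun (a : A) (_ : a ∈ 𝒜) =>
      ⨆ (_ : commNorm D (π a) ≤ 1), ‖ω₁ a - ω₂ a‖ₑ) a ha (le_iSup_of_le hL le_rfl)) h
  -- `ENNReal.ofReal r` is `0` for negative `r`, hence the maximum.
  rw [← ofReal_norm, ENNReal.ofReal_le_ofReal_iff'] at h1
  rcases h1 with h1 | h1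
  · exact h1.trans (le_max_left _ _)
  · exact h1.trans (le_max_right _ _)

theorem stateDist_le {H : Type*} [NormedAddCommGroup H] [InnerProductSpace ℂ H]
    [CompleteSpace H] {𝒜 : NonUnitalStarSubalgebra ℂ A} {π : A →⋆ₙₐ[ℂ] (H →L[ℂ] H)}
    {D : H →ₗ.[ℂ] H} {C : ℝ}
    (h : ∀ a ∈ 𝒜, commNorm D (π a) ≤ 1 → ∃ c : ℂ, ‖a - algebraMap ℂ A c‖ ≤ C)
    {ω₁ ω₂ : A →L[ℂ] ℂ} (h₁ : IsState ω₁) (h₂ : IsState ω₂) :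
    stateDist 𝒜 π D ω₁ ω₂ ≤ ENNReal.ofReal (2 * C) := by
  refine iSup_le fun a => iSup₂_le fun ha hL => ?_
  obtain ⟨c, hc⟩ := h a ha hL
  rw [← ofReal_norm]
  refine ENNReal.ofReal_le_ofReal ?_
  have h3 : ω₁ a - ω₂ a = ω₁ (a - algebraMap ℂ A c) - ω₂ (a - algebraMap ℂ A c) := by
    simp [Algebra.algebraMap_eq_smul_one, h₁.map_one, h₂.map_one]
  rw [h3]
  have h4 := norm_sub_le (ω₁ (a - algebraMap ℂ A c)) (ω₂ (a - algebraMap ℂ A c))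
  have h5 := h₁.norm_apply_le (a - algebraMap ℂ A c)
  have h6 := h₂.norm_apply_le (a - algebraMap ℂ A c)
  linarith

/-- The vector state of a unit vector. -/
theorem exists_isState_vector {H : Type*} [NormedAddCommGroup H] [InnerProductSpace ℂ H]
    [CompleteSpace H] (π : A →⋆ₐ[ℂ] (H →L[ℂ] H)) {x : H} (hx : ‖x‖ = 1) :
    ∃ ω : A →L[ℂ] ℂ, IsState ω ∧ ∀ a, ω a = ⟪x, π a x⟫_ℂ := by
  let f : A →ₗ[ℂ] ℂ :=
    { toFun := fun a => ⟪x, π a x⟫_ℂ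
      map_add' := fun a b => by simp
      map_smul' := fun c a => by simp }
  refine ⟨f.mkContinuous 1 fun a => ?_, ⟨fun a => ?_, ?_⟩, fun a => rfl⟩
  · refine (norm_inner_le_norm _ _).trans ?_
    have h1 := (π a).le_opNorm x
    have h2 : ‖π a‖ ≤ ‖a‖ := NonUnitalStarAlgHom.norm_apply_le π a
    rw [hx, mul_one] at h1
    rw [hx]
    linarith
  · change 0 ≤ ⟪x, π (star a * a) x⟫_ℂ
    rw [map_mul, map_star, ContinuousLinearMap.star_eq_adjoint]
    change 0 ≤ ⟪x, ContinuousLinearMap.adjoint (π a) (π a x)⟫_ℂ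
    rw [ContinuousLinearMap.adjoint_inner_right, inner_self_eq_norm_sq_to_K]
    have h1 : (0 : ℂ) ≤ ((‖π a x‖ ^ 2 : ℝ) : ℂ) := Complex.zero_le_real.2 (sq_nonneg _)
    rwa [Complex.ofReal_pow] at h1
  · change ⟪x, π 1 x⟫_ℂ = 1
    rw [map_one]
    change ⟪x, x⟫_ℂ = 1
    rw [inner_self_eq_norm_sq_to_K, hx]
    simp

/-- Finite diameter, tested on vector states only, bounds the numerical range of `a - ω₀ a` for a
fixed vector state `ω₀`, hence its norm. -/
theorem exists_norm_sub_algebraMap_le {H : Type*} [NormedAddCommGroup H] [InnerProductSpace ℂ H]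
    [CompleteSpace H] [Nontrivial H] {𝒜 : NonUnitalStarSubalgebra ℂ A}
    {π : A →⋆ₐ[ℂ] (H →L[ℂ] H)} (hπ : Function.Injective π) {D : H →ₗ.[ℂ] H}
    (h : RieffelMetricCondition 𝒜 π.toNonUnitalStarAlgHom D) :
    ∃ C : ℝ, ∀ a ∈ 𝒜, commNorm D (π a) ≤ 1 → ∃ c : ℂ, ‖a - algebraMap ℂ A c‖ ≤ C := by
  obtain ⟨r, hr⟩ := h.finite_diam
  obtain ⟨x₀, hx₀⟩ := exists_norm_eq H zero_le_one
  obtain ⟨ω₀, hω₀, hω₀'⟩ := exists_isState_vector π hx₀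
  refine ⟨2 * max r 0, fun a ha hL => ⟨ω₀ a, ?_⟩⟩
  rw [← NonUnitalStarAlgHom.norm_map π hπ]
  refine norm_le_of_numericalRange (fun x hx => ?_) (le_max_right _ _)
  obtain ⟨ω, hω, hω'⟩ := exists_isState_vector π hx
  have h1 := norm_sub_le_of_stateDist_le (hr ω ω₀ hω hω₀) ha hL
  rw [← hω', map_sub, Algebra.algebraMap_eq_smul_one, map_smul, hω.map_one, smul_eq_mul, mul_one]
  exact h1

end States

/-! ### Rieffel's metric condition for the extension. -/

section Rieffel

theorem totallyBounded_prod {α β : Type*} [UniformSpace α] [CompleteSpace α] [UniformSpace β]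
    [CompleteSpace β] {s : Set α} {t : Set β} (hs : TotallyBounded s) (ht : TotallyBounded t) :
    TotallyBounded (s ×ˢ t) :=
  ((hs.closure.isCompact_of_isClosed isClosed_closure).prod
    (ht.closure.isCompact_of_isClosed isClosed_closure)).totallyBounded.subset
      (Set.prod_mono subset_closure subset_closure)

variable {A E H : Type*} [CStarAlgebra A] [CStarAlgebra E]
  [NormedAddCommGroup H] [InnerProductSpace ℂ H] [CompleteSpace H]
  {𝒜 : NonUnitalStarSubalgebra ℂ A} {πA : A →⋆ₐ[ℂ] (H →L[ℂ] H)} {D : H →ₗ.[ℂ] H}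
  {P : H →L[ℂ] H} {σ : E →⋆ₐ[ℂ] A} {π : E →⋆ₙₐ[ℂ] (H →L[ℂ] H)}

theorem hasCommutator_of_extDirac {s : ℤˣ} {e : E} {T : Amp 6 H →L[ℂ] Amp 6 H}
    (hT : HasCommutator (extDirac s D P) (extRep πA σ π e) T) :
    ∃ S, HasCommutator D (πA (σ e)) S ∧ ‖S‖ ≤ ‖T‖ := by
  rw [extRep_apply, extDirac_eq] at hT
  refine ⟨PiLp.proj 2 (fun _ : Fin 6 => H) 0 ∘L T ∘L ampSingle 0,
    fun ξ => ⟨hT.diag_mem_domain 0 ξ, hT.entry 0 0 ξ⟩, ?_⟩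
  refine ContinuousLinearMap.opNorm_le_bound _ (norm_nonneg T) fun ξ => ?_
  refine (PiLp.norm_apply_le (T (ampSingle 0 ξ)) 0).trans ?_
  rw [← norm_ampSingle_apply (n := 6) 0 ξ]
  exact T.le_opNorm _

/-- On `P H`, `k D = P [D, a] - (P D a - π e P D)`: the `(0, 0)` entry of the commutator compressed
by `P`, minus its `(2, 5)` entry. -/
theorem norm_compact_part_apply_le {s : ℤˣ} {e : E} {T : Amp 6 H →L[ℂ] Amp 6 H}
    (hP : IsStarProjection P) (hc : HasCommutator D P 0)
    (hT : HasCommutator (extDirac s D P) (extRep πA σ π e) T) {k : H →L[ℂ] H}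
    (he : π e = P * πA (σ e) * P + k) (ξ : D.domain) (hξ : P ξ = ξ) :
    ‖k (D ξ)‖ ≤ 2 * ‖T‖ * ‖(ξ : H)‖ := by
  have hDξ : P (D ξ) = D ξ := by
    have h1 := hc.apply ξ
    rw [zero_apply, add_zero] at h1
    rw [← h1]
    exact congrArg D (Subtype.ext hξ)
  rw [extRep_apply, extDirac_eq] at hT
  have h1 := hT.norm_entry_le 0 0 ξ
  have h2 := hT.norm_entry_le 2 5 ξ
  have hm := hT.diag_mem_domain 0 ξ
  change ‖D ⟨πA (σ e) ξ, hm⟩ - πA (σ e) (D ξ)‖ ≤ _ at h1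
  change ‖P (D ⟨πA (σ e) ξ, hm⟩) - π e (P (D ξ))‖ ≤ _ at h2
  have h3 : k (D ξ) = P (D ⟨πA (σ e) ξ, hm⟩ - πA (σ e) (D ξ)) -
      (P (D ⟨πA (σ e) ξ, hm⟩) - π e (P (D ξ))) := by
    rw [hDξ, he]
    change _ = P (D ⟨πA (σ e) ξ, hm⟩ - πA (σ e) (D ξ)) - (P (D ⟨πA (σ e) ξ, hm⟩) -
      (P (πA (σ e) (P (D ξ))) + k (D ξ)))
    rw [hDξ, map_sub]
    abel
  have h4 : ∀ z, ‖P z‖ ≤ ‖z‖ := fun z =>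
    (P.le_of_opNorm_le hP.norm_le z).trans_eq (one_mul _)
  rw [h3]
  have h5 := norm_sub_le (P (D ⟨πA (σ e) ξ, hm⟩ - πA (σ e) (D ξ)))
    (P (D ⟨πA (σ e) ξ, hm⟩) - π e (P (D ξ)))
  have h6 := h4 (D ⟨πA (σ e) ξ, hm⟩ - πA (σ e) (D ξ))
  linarith

/-- The compact part of an element with bounded commutator is controlled by the inverse of
`D²` on `P H`. -/
theorem sq_norm_compact_part_le {s : ℤˣ} {e : E} {T : Amp 6 H →L[ℂ] Amp 6 H}
    (hD : IsSelfAdjoint D) (hP : IsStarProjection P) (hc : HasCommutator D P 0)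
    (hT : HasCommutator (extDirac s D P) (extRep πA σ π e) T) {k : H →L[ℂ] H}
    (hk : IsCompactOn P k) (he : π e = P * πA (σ e) * P + k) {W : H →L[ℂ] H}
    (hW : ∀ x, P (W x) = W x ∧ ∃ (h : W x ∈ D.domain) (h' : D ⟨W x, h⟩ ∈ D.domain),
      D ⟨D ⟨W x, h⟩, h'⟩ = P x) (x : H) :
    ‖k x‖ ^ 2 ≤ (2 * ‖T‖) ^ 2 * (‖x‖ * ‖W x‖) := by
  obtain ⟨h0, h1, h2, h3⟩ := hW x
  have hPP : P * P = P := hP.isIdempotentElem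
  have hkP : k (P x) = k x := by
    have : k * P = k := by rw [← hk.2, mul_assoc, hPP]
    exact DFunLike.congr_fun this x
  have hPD : P (D ⟨W x, h1⟩) = D ⟨W x, h1⟩ := by
    have h4 := hc.apply ⟨W x, h1⟩
    rw [zero_apply, add_zero] at h4
    rw [← h4]
    exact congrArg D (Subtype.ext h0)
  -- With `ξ = D W x` one has `D ξ = P x`, so this bounds `k x`.
  have h5 := norm_compact_part_apply_le hP hc hT he ⟨D ⟨W x, h1⟩, h2⟩ hPD
  rw [h3, hkP] at h5
  have h6 : ‖D ⟨W x, h1⟩‖ ^ 2 ≤ ‖x‖ * ‖W x‖ := by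
    -- `‖D W x‖² = ⟪D² W x, W x⟫ = ⟪P x, W x⟫ = ⟪x, W x⟫`.
    have h7 : (‖D ⟨W x, h1⟩‖ ^ 2 : ℂ) = ⟪x, W x⟫_ℂ := by
      have h8 : ⟪D ⟨W x, h1⟩, D ⟨W x, h1⟩⟫_ℂ = ⟪P x, W x⟫_ℂ := by
        rw [← h3]
        exact (inner_map_symm hD ⟨D ⟨W x, h1⟩, h2⟩ ⟨W x, h1⟩).symm
      have h9 : ⟪P x, W x⟫_ℂ = ⟪x, P (W x)⟫_ℂ :=
        ContinuousLinearMap.isSelfAdjoint_iff_isSymmetric.1 hP.isSelfAdjoint x (W x)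
      rw [h9, h0, inner_self_eq_norm_sq_to_K] at h8
      exact h8
    have h8 := norm_inner_le_norm (𝕜 := ℂ) x (W x)
    rw [← h7] at h8
    simpa using h8
  calc ‖k x‖ ^ 2 ≤ (2 * ‖T‖ * ‖D ⟨W x, h1⟩‖) ^ 2 := by gcongr
    _ = (2 * ‖T‖) ^ 2 * ‖D ⟨W x, h1⟩‖ ^ 2 := by ring
    _ ≤ _ := by gcongr

theorem rieffelMetricCondition_extDirac (hE : IsToeplitzExtension πA P σ π)
    (hP : IsToeplitzQuadruple 𝒜 πA D P) (hA : IsSpectralTriple 𝒜 πA.toNonUnitalStarAlgHom D)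
    (s : ℤˣ) (hinj : IsInjectiveOn D P)
    (hL : RieffelMetricCondition 𝒜 πA.toNonUnitalStarAlgHom D) :
    RieffelMetricCondition (smoothAlg 𝒜 πA D P π) (extRep πA σ π) (extDirac s D P) := by
  have hsa := isSelfAdjoint_extDirac hE hP hA s
  have hd := hsa.dense_domain
  have hproj := hE.projection
  have hPP : P * P = P := hproj.isIdempotentElem
  have hinjA : Function.Injective πA := hA.faithful
  have hσ : ∀ e ∈ smoothAlg 𝒜 πA D P π, σ e ∈ 𝒜 := fun e he => (smoothAlg_le hE hP hA s hsa he).1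
  have : Nontrivial H := by
    by_contra h
    rw [not_nontrivial_iff_subsingleton] at h
    exact hE.infinite inferInstance
  obtain ⟨R, hR, hRc⟩ := hA.compact_resolvent
  have hRc1 : IsCompactOperator R := by
    have := hRc 1
    rwa [show πA.toNonUnitalStarAlgHom 1 = 1 from map_one πA, one_mul] at this
  obtain ⟨W, hWc, hWsa, hW⟩ :=
    exists_compact_inverse_sq hA.selfAdjoint hproj hP.commute hR hRc1 hinj
  have hLσ : ∀ e : E, commNorm (extDirac s D P) (extRep πA σ π e) ≤ 1 →
      commNorm D (πA (σ e)) ≤ 1 := by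
    intro e he
    obtain ⟨T, hT, hT1⟩ := (commNorm_le_one_iff hd).1 he
    obtain ⟨S, hS, hST⟩ := hasCommutator_of_extDirac hT
    exact (commNorm_le_one_iff hA.dense_domain).2 ⟨S, hS, hST.trans hT1⟩
  have hk4 : ∀ (e : E) (k : H →L[ℂ] H), commNorm (extDirac s D P) (extRep πA σ π e) ≤ 1 →
      IsCompactOn P k → π e = P * πA (σ e) * P + k → ∀ x, ‖k x‖ ^ 2 ≤ 4 * (‖x‖ * ‖W x‖) := by
    intro e k he hk hek x
    obtain ⟨T, hT, hT1⟩ := (commNorm_le_one_iff hd).1 he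
    refine (sq_norm_compact_part_le hA.selfAdjoint hproj hP.commute hT hk hek hW x).trans ?_
    gcongr
    nlinarith [norm_nonneg T]
  constructor
  · intro _
    -- The representation is degenerate: it sends `1` to `1 ⊕ 1 ⊕ P ⊕ 1 ⊕ P ⊕ 1`, which still
    -- commutes with the Dirac operator.
    rw [extRep_apply, map_one σ, map_one πA, hE.pi_one,
      commNorm_eq hd (hasCommutator_extDirac_one s hproj hP.commute), enorm_zero]
  · intro e he h
    have hT := hasCommutator_zero_of_commNorm_eq_zero hd h
    obtain ⟨S, hS, hS0⟩ := hasCommutator_of_extDirac hT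
    rw [norm_zero, norm_le_zero_iff] at hS0
    obtain ⟨c, hc⟩ := hL.nondegenerate (σ e) (hσ e he)
      ((commNorm_eq hA.dense_domain hS).trans (by rw [hS0, enorm_zero]))
    obtain ⟨k, hk, hek⟩ := hE.decomposition e
    have hk0 : k = 0 := by
      ext x
      have h1 := sq_norm_compact_part_le hA.selfAdjoint hproj hP.commute hT hk hek hW x
      rw [norm_zero, mul_zero, zero_pow two_ne_zero, zero_mul] at h1
      simpa using h1
    refine ⟨c, hE.injective ?_⟩
    rw [hek, hc, hk0, add_zero, Algebra.algebraMap_eq_smul_one, Algebra.algebraMap_eq_smul_one,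
      map_smul, map_smul, map_one πA, hE.pi_one, mul_smul_comm, mul_one, smul_mul_assoc, hPP]
  · obtain ⟨C, hC⟩ := exists_norm_sub_algebraMap_le hinjA hL
    -- Modulo a scalar, `C` bounds the part from `A` and `√(4 * ‖W‖)` bounds `k`; the outer 2 comes
    -- from comparing two states.
    refine ⟨2 * (C + √(4 * ‖W‖)), fun ω₁ ω₂ h₁ h₂ => stateDist_le (fun e he hLe => ?_) h₁ h₂⟩
    obtain ⟨c, hc⟩ := hC (σ e) (hσ e he) (hLσ e hLe)
    obtain ⟨k, hk, hek⟩ := hE.decomposition e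
    refine ⟨c, ?_⟩
    have h1 : π (e - algebraMap ℂ E c) = P * πA (σ e - algebraMap ℂ A c) * P + k := by
      rw [map_sub, map_sub, hek, Algebra.algebraMap_eq_smul_one, Algebra.algebraMap_eq_smul_one,
        map_smul, map_smul, map_one πA, hE.pi_one, mul_sub, sub_mul, mul_smul_comm, mul_one,
        smul_mul_assoc, hPP]
      abel
    have h2 : ‖k‖ ≤ √(4 * ‖W‖) := opNorm_le_of_sq_le fun x => by
      refine (hk4 e k hLe hk hek x).trans ?_
      have := W.le_opNorm x
      calc _ ≤ 4 * (‖x‖ * (‖W‖ * ‖x‖)) := by gcongr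
        _ = _ := by ring
    have h3 : ‖πA (σ e - algebraMap ℂ A c)‖ ≤ C :=
      (NonUnitalStarAlgHom.norm_apply_le πA _).trans hc
    have hP1 : ‖P‖ ≤ 1 := hproj.norm_le
    rw [← NonUnitalStarAlgHom.norm_map π hE.injective, h1]
    have hC0 : 0 ≤ C := (norm_nonneg _).trans hc
    calc _ ≤ ‖P‖ * ‖πA (σ e - algebraMap ℂ A c)‖ * ‖P‖ + ‖k‖ := (norm_add_le _ _).trans
          (by gcongr; exact (norm_mul_le _ _).trans (by gcongr; exact norm_mul_le _ _))
      _ ≤ 1 * C * 1 + √(4 * ‖W‖) := by gcongr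
      _ = _ := by ring
  · have hiso : Isometry π := NonUnitalStarAlgHom.isometry π hE.injective
    have htb := totallyBounded_prod hL.totallyBounded (totallyBounded_of_le_compact hWc hWsa
      (by norm_num : (0 : ℝ) ≤ 4))
    -- `φ` rebuilds `π e` from `(σ e, k)`, so total boundedness passes from the pairs to `π e`, and
    -- to `e` by isometry.
    let φ : A × (H →L[ℂ] H) → (H →L[ℂ] H) := fun p => P * πA p.1 * P + p.2
    have hφ : LipschitzWith 2 φ := by
      refine LipschitzWith.of_dist_le_mul fun p q => ?_
      rw [dist_eq_norm, dist_eq_norm]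
      have h1 : φ p - φ q = P * πA (p - q).1 * P + (p - q).2 := by
        simp only [φ, Prod.fst_sub, Prod.snd_sub, map_sub, mul_sub, sub_mul]
        abel
      have h3 : ‖πA (p - q).1‖ ≤ ‖p - q‖ :=
        (NonUnitalStarAlgHom.norm_apply_le πA _).trans (norm_fst_le _)
      have h4 : ‖(p - q).2‖ ≤ ‖p - q‖ := norm_snd_le _
      have hP1 : ‖P‖ ≤ 1 := hproj.norm_le
      rw [h1]
      calc _ ≤ ‖P‖ * ‖πA (p - q).1‖ * ‖P‖ + ‖(p - q).2‖ := (norm_add_le _ _).trans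
            (by gcongr; exact (norm_mul_le _ _).trans (by gcongr; exact norm_mul_le _ _))
        _ ≤ 1 * ‖p - q‖ * 1 + ‖p - q‖ := by gcongr
        _ = 2 * ‖p - q‖ := by ring
    refine (totallyBounded_preimage hiso.isUniformInducing
      (htb.image hφ.uniformContinuous)).subset ?_
    rintro e ⟨he, hLe, hne⟩
    obtain ⟨k, hk, hek⟩ := hE.decomposition e
    have hek' : π (star e) = P * πA (σ (star e)) * P + star k := by
      rw [map_star, hek, map_star, map_star, star_add, star_mul, star_mul,
        hproj.isSelfAdjoint.star_eq, mul_assoc]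
    -- The kernel of `σ` is closed under adjoints, and exactness translates this to `k`.
    have hk' : IsCompactOn P (star k) := by
      obtain ⟨f, hf⟩ := hE.compacts_le_range k hk
      have hf0 : σ f = 0 := (hE.exact f).2 (hf ▸ hk)
      have := (hE.exact (star f)).1 (by rw [map_star, hf0, star_zero])
      rwa [map_star, hf] at this
    have hLe' : commNorm (extDirac s D P) (extRep πA σ π (star e)) ≤ 1 := by
      rw [map_star]; exact commNorm_star_le hsa hLe
    exact ⟨(σ e, k), ⟨⟨hσ e he, hLσ e hLe, (NonUnitalStarAlgHom.norm_apply_le σ e).trans hne⟩,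
      hk4 e k hLe hk hek, hk4 (star e) (star k) hLe' hk' hek'⟩, hek.symm⟩

end Rieffel

end ToeplitzExt

end

theorem mainTheorem7
    {A E H : Type*} [CStarAlgebra A] [TopologicalSpace.SeparableSpace A]
    [CStarAlgebra E] [TopologicalSpace.SeparableSpace E]
    [NormedAddCommGroup H] [InnerProductSpace ℂ H] [CompleteSpace H]
    [TopologicalSpace.SeparableSpace H]
    (𝒜 : NonUnitalStarSubalgebra ℂ A) (πA : A →⋆ₐ[ℂ] (H →L[ℂ] H)) (D : H →ₗ.[ℂ] H)
    (hA : ToeplitzExt.IsSpectralTriple 𝒜 πA.toNonUnitalStarAlgHom D)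
    (P : H →L[ℂ] H) (σ : E →⋆ₐ[ℂ] A) (π : E →⋆ₙₐ[ℂ] (H →L[ℂ] H))
    (hE : ToeplitzExt.IsToeplitzExtension πA P σ π)
    (hP : ToeplitzExt.IsToeplitzQuadruple 𝒜 πA D P)
    (s : ℤˣ) :
    ToeplitzExt.IsSpectralTriple (ToeplitzExt.smoothAlg 𝒜 πA D P π)
        (ToeplitzExt.extRep πA σ π) (ToeplitzExt.extDirac s D P) ∧
      ToeplitzExt.spectralDim (ToeplitzExt.extDirac s D P) = ToeplitzExt.spectralDim D ∧
      (ToeplitzExt.IsInjectiveOn D P →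
        ToeplitzExt.RieffelMetricCondition 𝒜 πA.toNonUnitalStarAlgHom D →
        ToeplitzExt.RieffelMetricCondition (ToeplitzExt.smoothAlg 𝒜 πA D P π)
          (ToeplitzExt.extRep πA σ π) (ToeplitzExt.extDirac s D P)) := by
  obtain ⟨R, hR, -⟩ := hA.compact_resolvent
  exact ⟨ToeplitzExt.isSpectralTriple_extDirac hE hP hA s,
    ToeplitzExt.spectralDim_matOp (by norm_num) hA.selfAdjoint
      (ToeplitzExt.extMat_mul_self s hE.projection) (ToeplitzExt.hasCommutator_extMat s hP.commute)
      hR,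
    ToeplitzExt.rieffelMetricCondition_extDirac hE hP hA s⟩
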